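/- For a graph $G$ on a finite vertex set, let $\delta(G)$ be its minimum degree, let PM be the property of containing a perfect matching, and let $$r_g(G,\mathrm{PM})=\min\{m\in\mathbb N : \text{there is a subgraph } H\subseteq G \text{ with exactly } m \text{ edges such that } G\setminus H \text{ has no perfect matching}\},$$ where $G\setminus H$ is $G$ with the edges of $H$ removed. Let $p=p(n)\in[0,1]$ be an arbitrary sequence and let $G\sim G(n,p(n))$ be the binomial random graph on $n$ vertices, in which each pair of vertices is an edge independently with probability $p(n)$. Then, as $n\to\infty$ through the even integers, $$\mathbb P\bigl(r_g(G,\mathrm{PM})=\delta(G)\bigr)\to 1.$$ -/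

import Mathlib

/-- The property PM: the graph contains a perfect matching. -/
def HasPerfectMatching {V : Type*} (G : SimpleGraph V) : Prop :=
  ∃ M : G.Subgraph, M.IsPerfectMatching

/-- The global resilience `r_g(G, P)` of a graph `G` on a finite vertex set with respect to a graph
property `P`: the minimum number of edges `e(H)` of a subgraph `H ⊆ G` such that `G \ H` (the graph
`G` with the edges of `H` removed) does not satisfy `P`. The minimum is over a nonempty set as soon
as the graph without edges fails `P`; this is so for perfect matchings whenever the vertex set
is nonempty. -/
noncomputable def globalResilience {V : Type*} [Finite V]
    (G : SimpleGraph V) (P : SimpleGraph V → Prop) : ℕ :=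
  sInf {m : ℕ | ∃ H : SimpleGraph V, H ≤ G ∧ H.edgeSet.ncard = m ∧ ¬ P (G \ H)}

/-! Deleting the edges at a vertex of minimum degree isolates it, so the resilience never exceeds δ.
Conversely, if fewer than δ edges destroy all perfect matchings, Tutte's theorem and parity give a
set U whose removal leaves at least |U| + 2 components. Grouping these yields a partition U, B, R
with fewer than δ edges of G between B and R, |R| ≥ n/8, and |B| > |U| or |B| ≥ n/4
(`exists_separation_of_globalResilience_ne`). It remains to rule out such partitions with high
probability, uniformly in p.

If np ≤ 0.9 log n, the second moment method gives an isolated vertex, and both quantities are 0.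
Otherwise δ ≤ 1.2np with high probability, and a union bound excludes |B| ≥ n/100; hence |U| < |B| <
n/100 (`exists_small_separation`). If np ≥ 100 log n, a union bound over B and a superset of U of
size |B| excludes the remaining sizes. For np in between, this works only for |B| ≥ n^0.85.

Smaller B are excluded by structure: small sets are sparse, codegrees are at most 2, and vertices of
degree below 30 are far apart. By `false_of_small_separation` such a graph has no bad partition:
low-degree vertices of B need almost as many private neighbours, and the other vertices of B have
too many edges for the sparse set in which they must lie. -/

namespace RandomGraph

/-! ### The binomial model as a finite weighted sum, and exponential moments. -/

open Finset Classical

variable {V : Type*} [Fintype V]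

/-- The probability of the graph `G` under the binomial model with parameter `p`. -/
noncomputable def weight (p : ℝ) (G : SimpleGraph V) : ℝ :=
  ∏ e ∈ (⊤ : SimpleGraph V).edgeFinset, if e ∈ G.edgeSet then p else 1 - p

/-- The probability of an event under the binomial model with parameter `p`. -/
noncomputable def prob (p : ℝ) (A : SimpleGraph V → Prop) : ℝ :=
  ∑ G with A G, weight p G

/-- The number of edges of `G` that belong to `E`. -/
noncomputable def edgeCount (E : Finset (Sym2 V)) (G : SimpleGraph V) : ℕ :=
  #{e ∈ E | e ∈ G.edgeSet}

lemma weight_nonneg {p : ℝ} (hp0 : 0 ≤ p) (hp1 : p ≤ 1) (G : SimpleGraph V) :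
    0 ≤ weight p G := by
  refine prod_nonneg fun e _ => ?_
  split_ifs <;> linarith

/-- Independence as a generating function: expanding the product of sums over subsets of pairs is
summing over graphs. -/
lemma sum_weight_mul_prod (p : ℝ) (f g : Sym2 V → ℝ) :
    ∑ G : SimpleGraph V, weight p G *
        ∏ e ∈ (⊤ : SimpleGraph V).edgeFinset, (if e ∈ G.edgeSet then f e else g e) =
      ∏ e ∈ (⊤ : SimpleGraph V).edgeFinset, (p * f e + (1 - p) * g e) := by
  rw [prod_add]
  refine sum_bij' (fun G _ => G.edgeFinset) (fun t _ => SimpleGraph.fromEdgeSet (t : Set (Sym2 V)))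
    ?_ ?_ ?_ ?_ ?_
  · intro G _
    rw [mem_powerset]
    exact SimpleGraph.edgeFinset_mono le_top
  · intro t _; simp
  · intro G _
    simp
  · intro t ht
    rw [mem_powerset] at ht
    ext e
    simp only [SimpleGraph.mem_edgeFinset, SimpleGraph.edgeSet_fromEdgeSet]
    constructor
    · rintro ⟨h, _⟩; exact h
    · intro h
      have := ht h
      simp only [SimpleGraph.mem_edgeFinset, SimpleGraph.edgeSet_top] at this
      exact ⟨h, this⟩
  · intro G _
    rw [weight, ← prod_mul_distrib,
      ← prod_sdiff (SimpleGraph.edgeFinset_mono (le_top : G ≤ ⊤)), mul_comm]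
    congr 1
    · refine prod_congr rfl fun e he => ?_
      rw [SimpleGraph.mem_edgeFinset] at he
      simp [he]
    · refine prod_congr rfl fun e he => ?_
      rw [mem_sdiff, SimpleGraph.mem_edgeFinset, SimpleGraph.mem_edgeFinset] at he
      simp [he.2]

/-- Each pair outside `E` contributes the factor p + (1 - p) = 1. -/
lemma sum_weight_mul_prod_of_subset (p : ℝ) (f : Sym2 V → ℝ) {E : Finset (Sym2 V)}
    (hE : E ⊆ (⊤ : SimpleGraph V).edgeFinset) :
    ∑ G : SimpleGraph V, weight p G * ∏ e ∈ E, (if e ∈ G.edgeSet then f e else 1) =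
      ∏ e ∈ E, (1 + (f e - 1) * p) := by
  have h := sum_weight_mul_prod p (fun e => if e ∈ E then f e else 1) (fun _ => (1 : ℝ))
  have h1 : ∀ G : SimpleGraph V, ∏ e ∈ E, (if e ∈ G.edgeSet then f e else 1) =
      ∏ e ∈ (⊤ : SimpleGraph V).edgeFinset,
        (if e ∈ G.edgeSet then (if e ∈ E then f e else 1) else 1) := by
    intro G
    rw [← prod_subset hE]
    · exact prod_congr rfl fun e he => by simp [he]
    · intro e _ he; simp [he]
  simp_rw [h1, h]
  rw [← prod_subset hE]
  · exact prod_congr rfl fun e he => by simp [he]; ring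
  · intro e _ he; simp [he]

lemma sum_weight (p : ℝ) : ∑ G : SimpleGraph V, weight p G = 1 := by
  simpa using sum_weight_mul_prod_of_subset (V := V) p (fun _ => 1) (E := ∅) (by simp)

lemma prod_ite_const {V : Type*} (E : Finset (Sym2 V)) (G : SimpleGraph V) (c : ℝ) :
    ∏ e ∈ E, (if e ∈ G.edgeSet then c else 1) = c ^ edgeCount E G := by
  rw [← prod_filter, prod_const, edgeCount]

/-- The joint moment generating function of two disjoint edge counts. -/
lemma sum_weight_mul_pow_mul_pow (p a c : ℝ) {E F : Finset (Sym2 V)}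
    (hE : E ⊆ (⊤ : SimpleGraph V).edgeFinset) (hF : F ⊆ (⊤ : SimpleGraph V).edgeFinset)
    (hEF : Disjoint E F) :
    ∑ G : SimpleGraph V, weight p G * (c ^ edgeCount E G * a ^ edgeCount F G) =
      (1 + (c - 1) * p) ^ #E * (1 + (a - 1) * p) ^ #F := by
  have h := sum_weight_mul_prod_of_subset p (fun e => if e ∈ E then c else a)
    (union_subset hE hF)
  have hne : ∀ e ∈ F, e ∉ E := fun e he he' => disjoint_left.1 hEF he' he
  simp_rw [prod_union hEF] at h
  have h2 : ∀ G : SimpleGraph V,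
      ∏ e ∈ E, (if e ∈ G.edgeSet then (if e ∈ E then c else a) else 1) = c ^ edgeCount E G :=
    fun G => by
      rw [← prod_ite_const]
      exact prod_congr rfl fun e he => by simp [he]
  have h3 : ∀ G : SimpleGraph V,
      ∏ e ∈ F, (if e ∈ G.edgeSet then (if e ∈ E then c else a) else 1) = a ^ edgeCount F G :=
    fun G => by
      rw [← prod_ite_const]
      exact prod_congr rfl fun e he => by simp [hne e he]
  simp_rw [h2, h3] at h
  rw [h]
  congr 1
  · rw [← prod_const]
    exact prod_congr rfl fun e he => by simp [he]
  · rw [← prod_const]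
    exact prod_congr rfl fun e he => by simp [hne e he]

lemma prob_nonneg {p : ℝ} (hp0 : 0 ≤ p) (hp1 : p ≤ 1) (A : SimpleGraph V → Prop) :
    0 ≤ prob p A := sum_nonneg fun G _ => weight_nonneg hp0 hp1 G

lemma prob_mono {p : ℝ} (hp0 : 0 ≤ p) (hp1 : p ≤ 1) {A B : SimpleGraph V → Prop}
    (h : ∀ G, A G → B G) : prob p A ≤ prob p B :=
  sum_le_sum_of_subset_of_nonneg (fun G => by simpa using h G)
    fun G _ _ => weight_nonneg hp0 hp1 G

lemma prob_le_sum {p : ℝ} (hp0 : 0 ≤ p) (hp1 : p ≤ 1) (A : SimpleGraph V → Prop)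
    (f : SimpleGraph V → ℝ) (hf0 : ∀ G, 0 ≤ f G) (hf : ∀ G, A G → 1 ≤ f G) :
    prob p A ≤ ∑ G, weight p G * f G := by
  rw [prob, sum_filter]
  refine sum_le_sum fun G _ => ?_
  have := weight_nonneg hp0 hp1 G
  split_ifs with h
  · nlinarith [hf G h]
  · exact mul_nonneg this (hf0 G)

lemma prob_or_le {p : ℝ} (hp0 : 0 ≤ p) (hp1 : p ≤ 1) (A B : SimpleGraph V → Prop) :
    prob p (fun G => A G ∨ B G) ≤ prob p A + prob p B := by
  have : ∀ G : SimpleGraph V, 0 ≤ weight p G := weight_nonneg hp0 hp1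
  simp only [prob, filter_or]
  exact le_trans (le_add_of_nonneg_right (sum_nonneg fun G _ => this G))
    (sum_union_inter (f := weight p)).le

lemma prob_exists_le {p : ℝ} (hp0 : 0 ≤ p) (hp1 : p ≤ 1) {ι : Type*} (s : Finset ι)
    (A : ι → SimpleGraph V → Prop) :
    prob p (fun G => ∃ i ∈ s, A i G) ≤ ∑ i ∈ s, prob p (A i) := by
  induction s using Finset.induction_on with
  | empty => simp [prob]
  | insert i s hi ih =>
    rw [sum_insert hi]
    refine le_trans (prob_mono hp0 hp1 ?_) ((prob_or_le hp0 hp1 _ _).trans (by gcongr))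
    intro G
    simp

lemma prob_add_prob_not (p : ℝ) (A : SimpleGraph V → Prop) :
    prob p A + prob p (fun G => ¬ A G) = 1 := by
  rw [prob, prob, sum_filter_add_sum_filter_not, sum_weight]

/-- Chernoff's bound for the event that `E` spans at least `m` edges while the disjoint set `F`
spans at most `k` edges. -/
lemma prob_le_edgeCount_and_edgeCount_le {p : ℝ} (hp0 : 0 ≤ p) (hp1 : p ≤ 1) {a c : ℝ}
    (hc : 1 ≤ c) (ha0 : 0 < a) (ha1 : a ≤ 1) {E F : Finset (Sym2 V)}
    (hE : E ⊆ (⊤ : SimpleGraph V).edgeFinset) (hF : F ⊆ (⊤ : SimpleGraph V).edgeFinset)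
    (hEF : Disjoint E F) (m k : ℕ) :
    prob p (fun G => m ≤ edgeCount E G ∧ edgeCount F G ≤ k) ≤
      (1 + (c - 1) * p) ^ #E / c ^ m * (Real.exp (-(1 - a) * p * #F) / a ^ k) := by
  have hc0 : 0 < c := by linarith
  have h := sum_weight_mul_pow_mul_pow p a c hE hF hEF
  -- Markov's inequality for c^X a^Y; the disjointness of `E` and `F` makes its expectation factor.
  have h1 : prob p (fun G : SimpleGraph V => m ≤ edgeCount E G ∧ edgeCount F G ≤ k) ≤
      ∑ G : SimpleGraph V, weight p G *
        (c ^ edgeCount E G * a ^ edgeCount F G * (1 / (c ^ m * a ^ k))) := by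
    refine prob_le_sum hp0 hp1 _ _ (fun G => by positivity) ?_
    rintro G ⟨h1, h2⟩
    rw [mul_one_div, one_le_div (by positivity)]
    gcongr ?_ * ?_
    · exact pow_le_pow_right₀ hc h1
    · exact pow_le_pow_of_le_one ha0.le ha1 h2
  refine h1.trans ?_
  simp_rw [← mul_assoc] at h ⊢
  rw [← sum_mul, h]
  have h4 : (1 + (a - 1) * p) ^ #F ≤ Real.exp (-(1 - a) * p * #F) := by
    have : 1 + (a - 1) * p ≤ Real.exp ((a - 1) * p) := by
      linarith [Real.add_one_le_exp ((a - 1) * p)]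
    calc (1 + (a - 1) * p) ^ #F ≤ Real.exp ((a - 1) * p) ^ #F := by
          gcongr
          nlinarith
      _ = _ := by rw [← Real.exp_nat_mul]; congr 1; ring
  have h5 : 0 ≤ 1 + (c - 1) * p := by nlinarith
  calc _ ≤ (1 + (c - 1) * p) ^ #E * Real.exp (-(1 - a) * p * #F) * (1 / (c ^ m * a ^ k)) := by
        gcongr
    _ = _ := by field_simp

lemma prob_edgeCount_le {p : ℝ} (hp0 : 0 ≤ p) (hp1 : p ≤ 1) {a : ℝ}
    (ha0 : 0 < a) (ha1 : a ≤ 1) {F : Finset (Sym2 V)}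
    (hF : F ⊆ (⊤ : SimpleGraph V).edgeFinset) (k : ℕ) :
    prob p (fun G => edgeCount F G ≤ k) ≤ Real.exp (-(1 - a) * p * #F) / a ^ k := by
  have h := prob_le_edgeCount_and_edgeCount_le hp0 hp1 (c := 1) le_rfl ha0 ha1
    (E := ∅) (by simp) hF (by simp) 0 k
  simpa using h

lemma prob_le_edgeCount {p : ℝ} (hp0 : 0 ≤ p) (hp1 : p ≤ 1) {c : ℝ}
    (hc : 1 ≤ c) {E : Finset (Sym2 V)}
    (hE : E ⊆ (⊤ : SimpleGraph V).edgeFinset) (m : ℕ) :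
    prob p (fun G => m ≤ edgeCount E G) ≤ Real.exp ((c - 1) * p * #E) / c ^ m := by
  have h := prob_le_edgeCount_and_edgeCount_le hp0 hp1 (a := 1) hc one_pos le_rfl
    hE (F := ∅) (by simp) (by simp) m 0
  have h2 : (1 + (c - 1) * p) ^ #E ≤ Real.exp ((c - 1) * p * #E) := by
    have : 1 + (c - 1) * p ≤ Real.exp ((c - 1) * p) := by
      linarith [Real.add_one_le_exp ((c - 1) * p)]
    calc (1 + (c - 1) * p) ^ #E ≤ Real.exp ((c - 1) * p) ^ #E := by
          gcongr
      _ = _ := by rw [← Real.exp_nat_mul]; congr 1; ring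
  refine le_trans (by simpa [edgeCount] using h) ?_
  have : (0:ℝ) < c := by linarith
  gcongr

lemma prob_edgeCount_eq_zero {p : ℝ} {F : Finset (Sym2 V)}
    (hF : F ⊆ (⊤ : SimpleGraph V).edgeFinset) :
    prob p (fun G => edgeCount F G = 0) = (1 - p) ^ #F := by
  -- With a = 0 and 0^0 = 1, the power a^Y is the indicator of Y = 0.
  have h := sum_weight_mul_pow_mul_pow p 0 1 (E := ∅) (F := F) (by simp) hF (by simp)
  simp only [one_pow, one_mul, sub_self, zero_mul, add_zero, zero_sub, neg_mul] at h
  rw [sub_eq_add_neg, ← h, prob, sum_filter]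
  refine sum_congr rfl fun G _ => ?_
  by_cases hG : edgeCount F G = 0 <;> simp [hG]

end RandomGraph

/-! ### Separations from Tutte's theorem. -/

namespace RandomGraph

open Finset Classical

/-- Take K of maximal cardinality whose complement weighs at least n/8. If the complement has at
most one element, K has more than u elements. If it has two, removing either leaves less than n/8,
so the complement weighs less than n/4; the total exceeds n/2, so K weighs more than n/4. -/
lemma exists_balanced_subset {ι : Type*} [Fintype ι] (w : ι → ℕ) (hw : ∀ i, 1 ≤ w i) {u n : ℕ}
    (hn : u + ∑ i, w i = n) (hc : u + 2 ≤ Fintype.card ι) :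
    ∃ K : Finset ι, n ≤ 8 * ∑ i ∈ Kᶜ, w i ∧ (u < ∑ i ∈ K, w i ∨ n ≤ 4 * ∑ i ∈ K, w i) := by
  have hcard : ∀ K : Finset ι, #K ≤ ∑ i ∈ K, w i := fun K => by
    simpa using card_nsmul_le_sum K w 1 fun i _ => hw i
  have hsum : ∀ K : Finset ι, ∑ i ∈ K, w i + ∑ i ∈ Kᶜ, w i = ∑ i, w i := fun K =>
    sum_add_sum_compl K w
  have hall := hcard univ
  rw [card_univ] at hall
  let S : Finset (Finset ι) := {K | n ≤ 8 * ∑ i ∈ Kᶜ, w i}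
  have hS : S.Nonempty := ⟨∅, by simp only [S, mem_filter, mem_univ, true_and, compl_empty]; omega⟩
  obtain ⟨K, hKS, hmax⟩ := exists_max_image S card hS
  have hK : n ≤ 8 * ∑ i ∈ Kᶜ, w i := by simpa [S] using hKS
  refine ⟨K, hK, ?_⟩
  have hstep : ∀ i ∈ Kᶜ, 8 * ∑ j ∈ Kᶜ.erase i, w j < n := by
    intro i hi
    by_contra! h
    have hi' : i ∉ K := by simpa using hi
    have : insert i K ∈ S := by simpa [S, compl_insert] using h
    have := hmax _ this
    rw [card_insert_of_notMem hi'] at this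
    omega
  have hKc : #K + #Kᶜ = Fintype.card ι := card_add_card_compl K
  by_cases h1 : #Kᶜ ≤ 1
  · left
    have := hcard K
    omega
  · right
    obtain ⟨i, hi, j, hj, hij⟩ := one_lt_card.1 (not_le.1 h1)
    have hi1 := hstep i hi
    have hj1 := hstep j hj
    have hi2 := add_sum_erase Kᶜ w hi
    have hj2 := single_le_sum (f := w) (fun _ _ => Nat.zero_le _)
      (mem_erase.2 ⟨hij, hi⟩ : i ∈ Kᶜ.erase j)
    have := hsum K
    omega

/-- If a graph of even order has no perfect matching, then its vertices split into `U`, `B`, `R`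
with no edge between `B` and `R`, where `R` is large and `B` is large or exceeds `U` in size. -/
lemma exists_separation {V : Type*} [Fintype V] {G : SimpleGraph V} (hV : Even (Fintype.card V))
    (h : ¬ HasPerfectMatching G) :
    ∃ U B R : Finset V, Disjoint U B ∧ Disjoint U R ∧ Disjoint B R ∧ U ∪ B ∪ R = univ ∧
      (∀ a ∈ B, ∀ b ∈ R, ¬ G.Adj a b) ∧ Fintype.card V ≤ 8 * #R ∧
      (#U < #B ∨ Fintype.card V ≤ 4 * #B) := by
  rw [HasPerfectMatching, SimpleGraph.tutte] at h
  push Not at h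
  obtain ⟨u, hu⟩ := h
  let H := ((⊤ : G.Subgraph).deleteVerts u)
  have hodd := SimpleGraph.odd_ncard_oddComponents H.coe
  rw [SimpleGraph.IsTutteViolator] at hu
  have hverts : H.verts = uᶜ := by simp [H, Set.compl_eq_univ_sdiff]
  have hcv : u.ncard + Nat.card H.verts = Fintype.card V := by
    rw [Nat.card_coe_set_eq, hverts, Set.ncard_add_ncard_compl, Nat.card_eq_fintype_card]
  have hle : H.coe.oddComponents.ncard ≤ Fintype.card H.coe.ConnectedComponent := by
    rw [← Nat.card_eq_fintype_card]
    exact Set.ncard_le_card _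
  -- The number of odd components has the parity of n - |u|, hence of |u|, so an excess of one is an
  -- excess of two.
  have hcomp : u.ncard + 2 ≤ Fintype.card H.coe.ConnectedComponent := by
    refine le_trans ?_ hle
    change u.ncard < H.coe.oddComponents.ncard at hu
    rw [Nat.odd_iff, Nat.odd_iff] at hodd
    rw [Nat.even_iff] at hV
    omega
  let T : H.coe.ConnectedComponent → Finset V := fun c => {v | ∃ hv : v ∈ H.verts, ⟨v, hv⟩ ∈ c.supp}
  have hTne : ∀ c, 1 ≤ #(T c) := by
    intro c
    obtain ⟨⟨v, hv⟩, hvc⟩ := c.nonempty_supp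
    exact card_pos.2 ⟨v, by simp only [T, mem_filter, mem_univ, true_and]; exact ⟨hv, hvc⟩⟩
  have hTdisj : ∀ c d, c ≠ d → Disjoint (T c) (T d) := by
    intro c d hcd
    rw [disjoint_left]
    intro v hc hd
    simp only [T, mem_filter, mem_univ, true_and] at hc hd
    obtain ⟨h1, h2⟩ := hc
    obtain ⟨_, h3⟩ := hd
    exact hcd (SimpleGraph.ConnectedComponent.eq_of_common_vertex h2 h3)
  have hbU : ∀ K : Finset H.coe.ConnectedComponent, #(K.biUnion T) = ∑ c ∈ K, #(T c) :=
    fun K => card_biUnion fun c _ d _ hcd => hTdisj c d hcd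
  have huniv : (univ.biUnion T : Finset V) = u.toFinsetᶜ := by
    ext v
    simp only [mem_biUnion, mem_univ, true_and, T, mem_filter, mem_compl, Set.mem_toFinset]
    constructor
    · rintro ⟨c, hv, _⟩
      rw [hverts] at hv
      exact hv
    · intro hv
      have hv' : v ∈ H.verts := by rw [hverts]; exact hv
      exact ⟨H.coe.connectedComponentMk ⟨v, hv'⟩, hv', rfl⟩
  have hsum : #u.toFinset + ∑ c, #(T c) = Fintype.card V := by
    rw [← hbU, huniv, card_add_card_compl]
  have hu' : u.ncard = #u.toFinset := Set.ncard_eq_toFinset_card' u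
  obtain ⟨K, hK1, hK2⟩ := exists_balanced_subset (fun c => #(T c)) hTne hsum (hu' ▸ hcomp)
  have hTu : ∀ K : Finset H.coe.ConnectedComponent, Disjoint u.toFinset (K.biUnion T) := by
    intro K
    refine disjoint_of_subset_right (biUnion_subset_biUnion_of_subset_left T (subset_univ K)) ?_
    rw [huniv]
    exact disjoint_compl_right
  refine ⟨u.toFinset, K.biUnion T, Kᶜ.biUnion T, hTu K, hTu Kᶜ, ?_, ?_, ?_, ?_, ?_⟩
  · rw [disjoint_biUnion_left]
    intro c hc
    rw [disjoint_biUnion_right]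
    intro d hd
    refine hTdisj c d ?_
    rintro rfl
    exact (mem_compl.1 hd) hc
  · rw [union_assoc, ← union_biUnion, union_compl, huniv, union_compl]
  · intro a ha b hb hab
    simp only [mem_biUnion, T, mem_filter, mem_univ, true_and] at ha hb
    obtain ⟨c, hc, ha1, ha2⟩ := ha
    obtain ⟨d, hd, hb1, hb2⟩ := hb
    have hadj : H.coe.Adj ⟨a, ha1⟩ ⟨b, hb1⟩ := by
      have ha3 := ha1
      have hb3 := hb1
      rw [hverts] at ha3 hb3
      simp only [H, SimpleGraph.Subgraph.coe_adj, SimpleGraph.Subgraph.deleteVerts_adj]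
      simp [hab, ha3.out, hb3.out]
    have := (SimpleGraph.ConnectedComponent.mem_supp_congr_adj c hadj).1 ha2
    have h3 := SimpleGraph.ConnectedComponent.eq_of_common_vertex this hb2
    subst h3
    exact (mem_compl.1 hd) hc
  · rw [hbU]; exact hK1
  · rw [hbU]; exact hK2

end RandomGraph

/-! ### Deterministic part: crossing edges, small separations, resilience. -/

namespace RandomGraph

open Finset Classical

variable {V : Type*}

/-- The number of pairs in `A × B` that are adjacent in `G`. -/
noncomputable def cross (G : SimpleGraph V) (A B : Finset V) : ℕ :=
  #{x ∈ A ×ˢ B | G.Adj x.1 x.2}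

lemma cross_eq_sum (G : SimpleGraph V) (A B : Finset V) :
    cross G A B = ∑ a ∈ A, #{b ∈ B | G.Adj a b} := by
  simp only [cross, card_filter, sum_product]

lemma cross_mono {G : SimpleGraph V} {A B A' B' : Finset V} (hA : A ⊆ A') (hB : B ⊆ B') :
    cross G A B ≤ cross G A' B' :=
  card_le_card (filter_subset_filter _ (product_subset_product hA hB))

lemma cross_union_right_le (G : SimpleGraph V) (A B C : Finset V) :
    cross G A (B ∪ C) ≤ cross G A B + cross G A C := by
  rw [cross, product_union, filter_union]
  exact card_union_le _ _

lemma cross_comm (G : SimpleGraph V) (A B : Finset V) : cross G A B = cross G B A := by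
  simp only [cross, card_filter, sum_product]
  rw [sum_comm]
  simp only [G.adj_comm]

lemma cross_le_card_mul {G : SimpleGraph V} {A B : Finset V} {k : ℕ}
    (h : ∀ a ∈ A, #{b ∈ B | G.Adj a b} ≤ k) : cross G A B ≤ #A * k := by
  rw [cross_eq_sum]
  exact sum_le_card_nsmul _ _ _ h

lemma cross_univ_right [Fintype V] (G : SimpleGraph V) (A : Finset V) :
    cross G A univ = ∑ a ∈ A, G.degree a := by
  rw [cross_eq_sum]
  refine sum_congr rfl fun a _ => ?_
  rw [← G.card_neighborFinset_eq_degree, G.neighborFinset_eq_filter]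

lemma card_mul_le_cross_univ [Fintype V] {G : SimpleGraph V} {A : Finset V} {k : ℕ}
    (h : ∀ a ∈ A, k ≤ G.degree a) : #A * k ≤ cross G A univ := by
  rw [cross_univ_right]
  exact card_nsmul_le_sum _ _ _ h

/-- In a locally sparse graph with bounded codegrees whose vertices of small degree are far apart,
a set `B` with small boundary outside a smaller set `U` cannot exist. -/
lemma false_of_small_separation [Fintype V] {G : SimpleGraph V} {U B R : Finset V} {δ : ℕ}
    (hδ : 1 ≤ δ) (hdeg : ∀ v, δ ≤ G.degree v) (hUB : Disjoint U B)
    (huniv : U ∪ B ∪ R = univ) (hcard : #U < #B) (hcross : cross G B R < δ)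
    (hsparse : ∀ S : Finset V, S.Nonempty → #S ≤ 3 * #B → cross G S S < 4 * #S)
    (hcod : ∀ v w, v ≠ w → #{x | G.Adj v x ∧ G.Adj w x} ≤ 2)
    (hfar₁ : ∀ v w, v ≠ w → G.degree v < 30 → G.degree w < 30 → ¬ G.Adj v w)
    (hfar₂ : ∀ v w, v ≠ w → G.degree v < 30 → G.degree w < 30 → ∀ x, G.Adj v x → ¬ G.Adj x w)
    (hfar₄ : ∀ v w, v ≠ w → G.degree v < 30 → G.degree w < 30 → ∀ x y z, y ≠ v → y ≠ w → x ≠ z →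
      G.Adj v x → G.Adj x y → G.Adj y z → ¬ G.Adj z w) : False := by
  -- A single vertex with U empty sends all its edges to R. Otherwise, counting edges at B gives
  -- |B|δ < 4(2|B| - 1) + δ, which fails for δ ≥ 12 and |B| ≥ 2.
  have hδ11 : δ ≤ 11 := by
    have h1 := card_mul_le_cross_univ (G := G) (A := B) (fun a _ => hdeg a)
    rw [← huniv] at h1
    have h2 := cross_union_right_le G B (U ∪ B) R
    by_cases hb : #B = 1
    · have hU : U = ∅ := by rw [← card_eq_zero]; omega
      subst hU
      obtain ⟨v, rfl⟩ := card_eq_one.1 hb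
      have : cross G {v} (∅ ∪ {v}) = 0 := by
        rw [cross_eq_sum]
        simp
      simp at h1 h2 hb
      simp at this
      omega
    · have h3 : cross G B (U ∪ B) ≤ cross G (U ∪ B) (U ∪ B) :=
        cross_mono subset_union_right subset_rfl
      have h4 := card_union_of_disjoint hUB
      have h5 := hsparse (U ∪ B) (card_pos.1 (by omega)) (by omega)
      by_contra! h6
      obtain ⟨b, hb'⟩ : ∃ b, #B = b + 2 := ⟨#B - 2, by omega⟩
      rw [hb'] at h1 hcard
      nlinarith [Nat.mul_le_mul_left b h6]
  let B₀ : Finset V := {v ∈ B | G.degree v < 30}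
  let B₁ : Finset V := {v ∈ B | ¬ G.degree v < 30}
  have hB : B₀ ∪ B₁ = B := filter_union_filter_not_eq _ _
  have hBcard : #B₀ + #B₁ = #B := card_filter_add_card_filter_not _
  have hB₀ : ∀ v ∈ B₀, G.degree v < 30 := fun v hv => (mem_filter.1 hv).2
  have hB₁ : ∀ v ∈ B₁, 30 ≤ G.degree v := fun v hv => not_lt.1 (mem_filter.1 hv).2
  have hone : ∀ v, #{b ∈ B₀ | G.Adj v b} ≤ 1 := by
    intro v
    rw [card_le_one]
    intro a ha b hb
    rw [mem_filter] at ha hb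
    by_contra hab
    exact hfar₂ a b hab (hB₀ a ha.1) (hB₀ b hb.1) v ha.2.symm hb.2
  let M : Finset V := {x ∈ U ∪ B₁ | ∃ l ∈ B₀, G.Adj x l}
  let W : Finset V := {x ∈ U | ∃ l ∈ B₀, G.Adj x l}
  let U' : Finset V := {x ∈ U | ¬ ∃ l ∈ B₀, G.Adj x l}
  have hUW : W ∪ U' = U := filter_union_filter_not_eq _ _
  have hUcard : #W + #U' = #U := card_filter_add_card_filter_not _
  have hMcard : #M ≤ #W + #B₁ := by
    refine (card_le_card (?_ : M ⊆ W ∪ B₁)).trans (card_union_le _ _)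
    intro x hx
    simp only [M, W, mem_filter, mem_union] at hx ⊢
    exact hx.1.imp (fun h => ⟨h, hx.2⟩) id
  have hcrossR : ∀ A ⊆ B, cross G A R < δ := fun A hA =>
    (cross_mono hA subset_rfl).trans_lt hcross
  -- No edges lie inside `B₀`, and each vertex sees at most one vertex of `B₀`, so |M| ≥ δ|B₀| - (δ
  -- - 1) ≥ |B₀|, using δ ≥ 1.
  have hB₀M : #B₀ ≤ #M := by
    by_cases h0 : #B₀ = 0
    · omega
    have h1 := card_mul_le_cross_univ (G := G) (A := B₀) (fun a _ => hdeg a)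
    have h2 : (univ : Finset V) = B₀ ∪ (U ∪ B₁) ∪ R := by
      rw [← huniv, ← hB]
      ext x; simp only [mem_union]; tauto
    rw [h2] at h1
    have h3 := cross_union_right_le G B₀ (B₀ ∪ (U ∪ B₁)) R
    have h4 := cross_union_right_le G B₀ B₀ (U ∪ B₁)
    have h5 : cross G B₀ B₀ = 0 := by
      rw [cross, card_eq_zero, filter_eq_empty_iff]
      rintro ⟨a, b⟩ hab hadj
      rw [mem_product] at hab
      exact hfar₁ a b hadj.ne (hB₀ a hab.1) (hB₀ b hab.2) hadj
    have h6 : cross G B₀ (U ∪ B₁) ≤ #M := by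
      rw [cross_comm, cross_eq_sum, ← sum_filter_add_sum_filter_not _ (fun x => ∃ l ∈ B₀, G.Adj x l)]
      have h7 : ∑ x ∈ U ∪ B₁ with ¬ ∃ l ∈ B₀, G.Adj x l, #{b ∈ B₀ | G.Adj x b} = 0 := by
        refine sum_eq_zero fun x hx => ?_
        rw [mem_filter] at hx
        rw [card_eq_zero, filter_eq_empty_iff]
        intro l hl hxl
        exact hx.2 ⟨l, hl, hxl⟩
      rw [h7, add_zero]
      refine (sum_le_card_nsmul _ _ 1 fun x _ => hone x).trans ?_
      simp [M]
    have h8 := hcrossR B₀ (filter_subset _ _)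
    obtain ⟨k, hk⟩ := Nat.exists_eq_succ_of_ne_zero h0
    rw [hk] at h1 ⊢
    obtain ⟨δ, rfl⟩ : ∃ d, δ = d + 1 := ⟨δ - 1, by omega⟩
    have : (k.succ) * (δ + 1) = k * δ + k + δ + 1 := by rw [Nat.succ_eq_add_one]; ring
    have := Nat.zero_le (k * δ)
    omega
  -- |W| + |U'| = |U| < |B₀| + |B₁| ≤ |M| + |B₁| ≤ |W| + 2|B₁|.
  have hU'card : #U' + 1 ≤ 2 * #B₁ := by omega
  have h1 := card_mul_le_cross_univ hB₁
  have h2 : (univ : Finset V) = B₀ ∪ (W ∪ (B₁ ∪ U')) ∪ R := by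
    rw [← huniv, ← hB, ← hUW]
    ext x; simp only [mem_union]; tauto
  rw [h2] at h1
  have h3 := cross_union_right_le G B₁ (B₀ ∪ (W ∪ (B₁ ∪ U'))) R
  have h4 := cross_union_right_le G B₁ B₀ (W ∪ (B₁ ∪ U'))
  have h5 := cross_union_right_le G B₁ W (B₁ ∪ U')
  have h6 : cross G B₁ B₀ ≤ #B₁ * 1 := cross_le_card_mul fun v _ => hone v
  -- Two neighbours of v in `W` with different low neighbours would close a forbidden path of length
  -- four. So all share one low neighbour l, and the codegree of v and l bounds their number.
  have h7 : cross G B₁ W ≤ #B₁ * 2 := by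
    refine cross_le_card_mul fun v hv => ?_
    by_cases hne : ({b ∈ W | G.Adj v b}).Nonempty
    · obtain ⟨x, hx⟩ := hne
      simp only [W, mem_filter] at hx
      obtain ⟨⟨_, l, hl, hxl⟩, hvx⟩ := hx
      have hvlow : ∀ l ∈ B₀, v ≠ l := by
        rintro l hl rfl
        have := hB₀ v hl
        have := hB₁ v hv
        omega
      refine (card_le_card ?_).trans (hcod v l (hvlow l hl))
      intro y hy
      simp only [W, mem_filter, mem_univ, true_and] at hy ⊢
      obtain ⟨⟨_, l', hl', hyl'⟩, hvy⟩ := hy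
      refine ⟨hvy, ?_⟩
      by_contra hly
      have hll' : l ≠ l' := by rintro rfl; exact hly hyl'.symm
      refine hfar₄ l l' hll' (hB₀ l hl) (hB₀ l' hl') x v y (hvlow l hl) (hvlow l' hl') ?_
        hxl.symm hvx.symm hvy hyl'
      rintro rfl
      exact hly hxl.symm
    · rw [not_nonempty_iff_eq_empty.1 hne]; simp
  have h8 := card_union_le B₁ U'
  have h9 := hsparse (B₁ ∪ U') ((card_pos.1 (by omega : 0 < #B₁)).mono subset_union_left) (by omega)
  have h10 : cross G B₁ (B₁ ∪ U') ≤ cross G (B₁ ∪ U') (B₁ ∪ U') :=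
    cross_mono subset_union_left subset_rfl
  have h11 := hcrossR B₁ (filter_subset _ _)
  -- The degrees in `B₁` sum to at least 30|B₁|, but to less than |B₁| + 2|B₁| + 4·3|B₁| + 11 ≤
  -- 26|B₁|.
  omega

/-- Edges between two sides of a separation of `G \ H` all belong to `H`. -/
lemma cross_le_ncard_edgeSet [Finite V] {G H : SimpleGraph V} {B R : Finset V} (hBR : Disjoint B R)
    (h : ∀ a ∈ B, ∀ b ∈ R, ¬ (G \ H).Adj a b) : cross G B R ≤ H.edgeSet.ncard := by
  rw [cross, ← Set.ncard_coe_finset]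
  refine Set.ncard_le_ncard_of_injOn (fun x => s(x.1, x.2)) ?_ ?_ (Set.toFinite _)
  · rintro ⟨a, b⟩ hab
    simp only [coe_filter, mem_product, Set.mem_ofPred_eq] at hab
    have := h a hab.1.1 b hab.1.2
    rw [SimpleGraph.sdiff_adj] at this
    by_contra h'
    exact this ⟨hab.2, h'⟩
  · rintro ⟨a, b⟩ hab ⟨c, d⟩ hcd heq
    simp only [coe_filter, mem_product, Set.mem_ofPred_eq] at hab hcd
    rcases Sym2.eq_iff.1 heq with ⟨h1, h2⟩ | ⟨h1, h2⟩
    · exact Prod.ext h1 h2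
    · simp only at h1 h2
      exact absurd (h1 ▸ hab.1.1) (disjoint_right.1 hBR hcd.1.2)

/-- Removing the edges at v leaves v unmatched. -/
lemma globalResilience_le_degree [Fintype V] (G : SimpleGraph V) (v : V) :
    globalResilience G HasPerfectMatching ≤ G.degree v := by
  refine Nat.sInf_le ⟨SimpleGraph.fromEdgeSet (G.incidenceSet v), ?_, ?_, ?_⟩
  · rw [← G.fromEdgeSet_edgeSet]
    exact SimpleGraph.fromEdgeSet_mono (G.fromEdgeSet_edgeSet.symm ▸ G.incidenceSet_subset v)
  · have : (SimpleGraph.fromEdgeSet (G.incidenceSet v)).edgeSet = G.incidenceSet v := by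
      rw [SimpleGraph.edgeSet_fromEdgeSet]
      refine sdiff_eq_left.2 (Set.disjoint_left.2 fun e he hd => ?_)
      exact G.not_isDiag_of_mem_edgeSet (G.incidenceSet_subset v he) hd
    rw [this, ← G.card_incidenceSet_eq_degree, ← Nat.card_coe_set_eq, Nat.card_eq_fintype_card]
  · rintro ⟨M, hM⟩
    obtain ⟨w, hw, _⟩ := hM.1 (hM.2 v)
    have := M.adj_sub hw
    rw [SimpleGraph.sdiff_adj] at this
    refine this.2 ?_
    rw [SimpleGraph.fromEdgeSet_adj]
    exact ⟨⟨this.1, Sym2.mem_mk_left v w⟩, this.1.ne⟩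

/-- If the resilience of a graph of even order differs from its minimum degree, then the graph has
a separation crossed by fewer edges than the minimum degree. -/
lemma exists_separation_of_globalResilience_ne [Fintype V] [Nonempty V] {G : SimpleGraph V}
    (hV : Even (Fintype.card V)) (h : globalResilience G HasPerfectMatching ≠ G.minDegree) :
    ∃ U B R : Finset V, Disjoint U B ∧ Disjoint U R ∧ Disjoint B R ∧ U ∪ B ∪ R = univ ∧
      cross G B R < G.minDegree ∧ Fintype.card V ≤ 8 * #R ∧
      (#U < #B ∨ Fintype.card V ≤ 4 * #B) := by
  obtain ⟨v, hv⟩ := G.exists_minimal_degree_vertex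
  have hlt : globalResilience G HasPerfectMatching < G.minDegree :=
    lt_of_le_of_ne (hv ▸ globalResilience_le_degree G v) h
  -- Attaining the infimum needs a nonempty set, since `sInf ∅ = 0` in ℕ; removing every edge is a
  -- witness.
  have hne : {m : ℕ | ∃ H : SimpleGraph V, H ≤ G ∧ H.edgeSet.ncard = m ∧
      ¬ HasPerfectMatching (G \ H)}.Nonempty := by
    by_contra hemp
    refine hemp ⟨G.edgeSet.ncard, G, le_rfl, rfl, ?_⟩
    rintro ⟨M, hM⟩
    obtain ⟨w, hw, _⟩ := hM.1 (hM.2 v)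
    simpa using M.adj_sub hw
  obtain ⟨H, _, hcard, hH⟩ := Nat.sInf_mem hne
  obtain ⟨U, B, R, h1, h2, h3, h4, h5, h6, h7⟩ := exists_separation hV hH
  refine ⟨U, B, R, h1, h2, h3, h4, ?_, h6, h7⟩
  refine lt_of_le_of_lt (cross_le_ncard_edgeSet h3 h5) ?_
  rw [hcard]
  exact hlt

end RandomGraph

/-! ### Union bounds for the exceptional events. -/

namespace RandomGraph

open Finset Classical

variable {V : Type*}

/-- The unordered pairs with one element in `A` and the other in `B`. -/
noncomputable def pairsBetween (A B : Finset V) : Finset (Sym2 V) :=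
  (A ×ˢ B).image fun x => s(x.1, x.2)

/-- The unordered pairs of distinct elements of `S`. -/
noncomputable def pairsWithin (S : Finset V) : Finset (Sym2 V) :=
  {e ∈ pairsBetween S S | ¬ e.IsDiag}

lemma injOn_mk_of_disjoint {A B : Finset V} (h : Disjoint A B) :
    Set.InjOn (fun x : V × V => s(x.1, x.2)) (A ×ˢ B : Finset (V × V)) := by
  rintro ⟨a, b⟩ hab ⟨c, d⟩ hcd heq
  simp only [mem_coe, mem_product] at hab hcd
  rcases Sym2.eq_iff.1 heq with ⟨h1, h2⟩ | ⟨h1, h2⟩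
  · exact Prod.ext h1 h2
  · simp only at h1 h2
    exact absurd (h1 ▸ hab.1) (disjoint_right.1 h hcd.2)

lemma card_pairsBetween {A B : Finset V} (h : Disjoint A B) : #(pairsBetween A B) = #A * #B := by
  rw [pairsBetween, card_image_of_injOn (injOn_mk_of_disjoint h), card_product]

lemma edgeCount_pairsBetween {A B : Finset V} (h : Disjoint A B) (G : SimpleGraph V) :
    edgeCount (pairsBetween A B) G = cross G A B := by
  rw [edgeCount, pairsBetween, filter_image, card_image_of_injOn]
  · rfl
  · exact (injOn_mk_of_disjoint h).mono (coe_subset.2 (filter_subset _ _))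

lemma card_pairsWithin_le (S : Finset V) : #(pairsWithin S) ≤ #S ^ 2 := by
  refine (card_filter_le _ _).trans (card_image_le.trans ?_)
  rw [card_product, sq]

/-- Each edge inside S is counted in both orders; this explains the doubled thresholds 4|S|, 12 and
2(|S| - 1) used later. -/
lemma cross_self_le (G : SimpleGraph V) (S : Finset V) :
    cross G S S ≤ 2 * edgeCount (pairsWithin S) G := by
  have h : ({x ∈ S ×ˢ S | G.Adj x.1 x.2}).image (fun x => s(x.1, x.2)) ⊆
      {e ∈ pairsWithin S | e ∈ G.edgeSet} := by
    intro e he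
    rw [mem_image] at he
    obtain ⟨⟨a, b⟩, hab, rfl⟩ := he
    rw [mem_filter] at hab
    rw [mem_filter, pairsWithin, mem_filter, pairsBetween]
    refine ⟨⟨mem_image_of_mem (fun x : V × V => s(x.1, x.2)) hab.1, ?_⟩, hab.2⟩
    simpa using hab.2.ne
  refine (card_le_mul_card_image _ 2 fun e _ => ?_).trans (Nat.mul_le_mul_left 2 (card_le_card h))
  induction e with
  | _ a b =>
    refine (card_le_card (t := {(a, b), (b, a)}) ?_).trans card_le_two
    rintro ⟨c, d⟩ hcd
    rw [mem_filter] at hcd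
    simpa [Prod.ext_iff] using hcd.2

section

variable [Fintype V]

lemma pairsBetween_subset {A B : Finset V} (h : Disjoint A B) :
    pairsBetween A B ⊆ (⊤ : SimpleGraph V).edgeFinset := by
  intro e he
  rw [pairsBetween, mem_image] at he
  obtain ⟨⟨a, b⟩, hab, rfl⟩ := he
  rw [mem_product] at hab
  rw [SimpleGraph.mem_edgeFinset, SimpleGraph.mem_edgeSet, SimpleGraph.top_adj]
  intro heq
  exact disjoint_left.1 h hab.1 (by rw [show a = b from heq]; exact hab.2)

lemma pairsWithin_subset (S : Finset V) : pairsWithin S ⊆ (⊤ : SimpleGraph V).edgeFinset := by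
  intro e he
  rw [pairsWithin, mem_filter] at he
  rw [SimpleGraph.mem_edgeFinset, SimpleGraph.edgeSet_top]
  exact he.2

lemma disjoint_pairsWithin_pairsBetween (S A : Finset V) :
    Disjoint (pairsWithin S) (pairsBetween A Sᶜ) := by
  rw [disjoint_left]
  intro e he he'
  rw [pairsWithin, mem_filter, pairsBetween, mem_image] at he
  rw [pairsBetween, mem_image] at he'
  obtain ⟨⟨⟨a, b⟩, hab, rfl⟩, _⟩ := he
  obtain ⟨⟨c, d⟩, hcd, heq⟩ := he'
  rw [mem_product] at hab hcd
  rw [mem_compl] at hcd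
  rcases Sym2.eq_iff.1 heq with ⟨h1, h2⟩ | ⟨h1, h2⟩
  · exact hcd.2 (h2 ▸ hab.2)
  · exact hcd.2 (h2 ▸ hab.1)

/-- The lower tail with a = 1/2; the coefficient 7/10 exceeds log 2. -/
lemma prob_edgeCount_le_exp {p : ℝ} (hp0 : 0 ≤ p) (hp1 : p ≤ 1) {F : Finset (Sym2 V)}
    (hF : F ⊆ (⊤ : SimpleGraph V).edgeFinset) {y : ℝ} (hy : 0 ≤ y) :
    prob p (fun G => (edgeCount F G : ℝ) ≤ y) ≤ Real.exp (-(p * #F / 2) + y * (7 / 10)) := by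
  have h := prob_edgeCount_le hp0 hp1 (a := 1 / 2) (by norm_num) (by norm_num) hF ⌊y⌋₊
  simp_rw [Nat.le_floor_iff hy] at h
  refine h.trans ?_
  rw [Real.exp_add, div_eq_mul_inv]
  gcongr
  · apply le_of_eq; ring
  · rw [one_div, inv_pow, inv_inv, ← Real.rpow_natCast, Real.rpow_def_of_pos two_pos, mul_comm]
    have := Nat.floor_le hy
    have := Real.log_two_lt_d9
    have := Real.log_pos one_lt_two
    gcongr
    linarith

/-- The minimum degree is unlikely to exceed the expected average degree by a fifth. -/
lemma prob_lt_minDegree_le {p : ℝ} (hp0 : 0 ≤ p) (hp1 : p ≤ 1) :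
    prob p (fun G : SimpleGraph V => 6 / 5 * (Fintype.card V * p) < G.minDegree) ≤
      Real.exp (-(Fintype.card V * p * Fintype.card V / 200)) := by
  set n := Fintype.card V with hn
  set K := (⊤ : SimpleGraph V).edgeFinset with hK
  have hKcard : (#K : ℝ) ≤ n * n / 2 := by
    have h1 : #K = n.choose 2 := by
      rw [hK, hn, SimpleGraph.card_edgeFinset_top_eq_card_choose_two]
    rw [h1, Nat.cast_choose_two]
    have : (0 : ℝ) ≤ n := by positivity
    nlinarith
  have hsub : ∀ G : SimpleGraph V, 6 / 5 * (n * p) < G.minDegree →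
      ⌈3 / 5 * (n * p * n)⌉₊ ≤ edgeCount K G := by
    intro G hG
    have h1 : edgeCount K G = #G.edgeFinset := by
      rw [edgeCount]
      congr 1
      ext e
      simp only [K, mem_filter, SimpleGraph.mem_edgeFinset, and_iff_right_iff_imp]
      exact fun he => SimpleGraph.edgeSet_mono le_top he
    have h2 := card_mul_le_cross_univ (G := G) (A := univ) fun v _ => G.minDegree_le_degree v
    rw [cross_univ_right, SimpleGraph.sum_degrees_eq_twice_card_edges, ← h1, card_univ, ← hn] at h2
    rw [Nat.ceil_le]
    have h3 : (n : ℝ) * G.minDegree ≤ 2 * edgeCount K G := by exact_mod_cast h2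
    have : (n : ℝ) * (6 / 5 * (n * p)) ≤ n * G.minDegree := by gcongr
    linarith
  refine (prob_mono hp0 hp1 hsub).trans ?_
  refine (prob_le_edgeCount hp0 hp1 (c := 6 / 5) (by norm_num) subset_rfl _).trans ?_
  -- The exponent in units of n²p is 1/10 - (3/5) log(6/5), so a bound above 1/6 is needed; 2/11
  -- gives -1/110.
  have hlog : (2 : ℝ) / 11 ≤ Real.log (6 / 5) := by
    have := Real.le_log_one_add_of_nonneg (x := 1 / 5) (by norm_num)
    norm_num at this ⊢
    exact this
  have hx : (0 : ℝ) ≤ n * p * n := by positivity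
  have h4 : Real.exp (3 / 5 * (n * p * n) * (2 / 11)) ≤ (6 / 5 : ℝ) ^ ⌈3 / 5 * (n * p * n)⌉₊ := by
    rw [← Real.rpow_natCast, Real.rpow_def_of_pos (by norm_num), mul_comm (Real.log _)]
    gcongr
    exact Nat.le_ceil _
  calc _ ≤ Real.exp ((6 / 5 - 1) * p * (n * n / 2)) / Real.exp (3 / 5 * (n * p * n) * (2 / 11)) := by
        gcongr
    _ ≤ _ := by
        rw [← Real.exp_sub]
        gcongr
        linarith

/-- Few edges between two large sets are unlikely. -/
lemma prob_exists_large_cross_le {p y : ℝ} (hp0 : 0 ≤ p) (hp1 : p ≤ 1) (hy : 0 ≤ y) :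
    prob p (fun G : SimpleGraph V => ∃ x : Finset V × Finset V, Disjoint x.1 x.2 ∧
        Fintype.card V ≤ 100 * #x.1 ∧ Fintype.card V ≤ 8 * #x.2 ∧ (cross G x.1 x.2 : ℝ) ≤ y) ≤
      4 ^ Fintype.card V *
        Real.exp (-(Fintype.card V * p * Fintype.card V / 1600) + y * (7 / 10)) := by
  set n := Fintype.card V with hn
  let I : Finset (Finset V × Finset V) := {x | Disjoint x.1 x.2 ∧ n ≤ 100 * #x.1 ∧ n ≤ 8 * #x.2}
  have h1 : #I ≤ 4 ^ n := by
    refine (card_le_univ I).trans ?_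
    rw [Fintype.card_prod, Fintype.card_finset, ← hn, ← mul_pow]
    norm_num
  calc _ ≤ prob p (fun G : SimpleGraph V => ∃ x ∈ I, (cross G x.1 x.2 : ℝ) ≤ y) := by
        refine prob_mono hp0 hp1 ?_
        rintro G ⟨x, h1, h2, h3, h4⟩
        exact ⟨x, by simp only [I, mem_filter, mem_univ, true_and]; exact ⟨h1, h2, h3⟩, h4⟩
    _ ≤ ∑ x ∈ I, prob p (fun G : SimpleGraph V => (cross G x.1 x.2 : ℝ) ≤ y) :=
        prob_exists_le hp0 hp1 _ _
    _ ≤ ∑ x ∈ I, Real.exp (-(n * p * n / 1600) + y * (7 / 10)) := by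
        refine sum_le_sum fun x hx => ?_
        simp only [I, mem_filter, mem_univ, true_and] at hx
        obtain ⟨hd, hb, hr⟩ := hx
        simp_rw [← edgeCount_pairsBetween hd]
        refine (prob_edgeCount_le_exp hp0 hp1 (pairsBetween_subset hd) hy).trans ?_
        rw [card_pairsBetween hd]
        have hb' : (n : ℝ) ≤ 100 * #x.1 := by exact_mod_cast hb
        have hr' : (n : ℝ) ≤ 8 * #x.2 := by exact_mod_cast hr
        have : (n : ℝ) * n ≤ 100 * #x.1 * (8 * #x.2) := by gcongr
        have := mul_le_mul_of_nonneg_left this hp0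
        push_cast
        refine Real.exp_le_exp.2 ?_
        linarith
    _ ≤ _ := by
        rw [sum_const, nsmul_eq_mul]
        gcongr
        exact_mod_cast h1

/-- Few edges leaving the union of two small sets of equal size are unlikely. -/
lemma prob_exists_small_cross_le {p y : ℝ} (hp0 : 0 ≤ p) (hp1 : p ≤ 1) (hy : 0 ≤ y)
    (I : Finset ℕ) (hI : ∀ b ∈ I, 100 * b ≤ Fintype.card V) :
    prob p (fun G : SimpleGraph V => ∃ b ∈ I, ∃ x : Finset V × Finset V, Disjoint x.1 x.2 ∧
        #x.1 = b ∧ #x.2 = b ∧ (cross G x.1 (x.1 ∪ x.2)ᶜ : ℝ) ≤ y) ≤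
      ∑ b ∈ I, (Fintype.card V).choose b ^ 2 *
        Real.exp (-(49 / 100 * (b * (Fintype.card V * p))) + y * (7 / 10)) := by
  set n := Fintype.card V with hn
  refine (prob_exists_le hp0 hp1 _ _).trans (sum_le_sum fun b hb => ?_)
  let J : Finset (Finset V × Finset V) := powersetCard b univ ×ˢ powersetCard b univ
  have hJ : #J = n.choose b ^ 2 := by
    rw [card_product, card_powersetCard, card_univ, ← hn, sq]
  have hb' : (100 : ℝ) * b ≤ n := by exact_mod_cast hI b hb
  calc _ ≤ prob p (fun G : SimpleGraph V => ∃ x ∈ J,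
          Disjoint x.1 x.2 ∧ (cross G x.1 (x.1 ∪ x.2)ᶜ : ℝ) ≤ y) := by
        refine prob_mono hp0 hp1 ?_
        rintro G ⟨x, h1, h2, h3, h4⟩
        exact ⟨x, by simp [J, h2, h3], h1, h4⟩
    _ ≤ ∑ x ∈ J, prob p (fun G : SimpleGraph V =>
          Disjoint x.1 x.2 ∧ (cross G x.1 (x.1 ∪ x.2)ᶜ : ℝ) ≤ y) :=
        prob_exists_le hp0 hp1 _ _
    _ ≤ ∑ x ∈ J, Real.exp (-(49 / 100 * (b * (n * p))) + y * (7 / 10)) := by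
        refine sum_le_sum fun x hx => ?_
        simp only [J, mem_product, mem_powersetCard_univ] at hx
        have hd : Disjoint x.1 (x.1 ∪ x.2)ᶜ :=
          disjoint_of_subset_left subset_union_left disjoint_compl_right
        refine (prob_mono hp0 hp1 fun G h => h.2).trans ?_
        simp_rw [← edgeCount_pairsBetween hd]
        refine (prob_edgeCount_le_exp hp0 hp1 (pairsBetween_subset hd) hy).trans ?_
        rw [card_pairsBetween hd, hx.1]
        have h1 : #(x.1 ∪ x.2) + #(x.1 ∪ x.2)ᶜ = n := card_add_card_compl _
        have h2 := card_union_le x.1 x.2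
        have h3 : (n : ℝ) ≤ b + b + #(x.1 ∪ x.2)ᶜ := by
          rw [hx.1, hx.2] at h2
          exact_mod_cast (by omega : n ≤ b + b + #(x.1 ∪ x.2)ᶜ)
        -- Two sets of size at most n/100 are removed; half of 98/100 is the 49/100 of the bound.
        have h4 : (98 : ℝ) / 100 * n ≤ #(x.1 ∪ x.2)ᶜ := by linarith
        have h5 : (b : ℝ) * p * (98 / 100 * n) ≤ b * p * #(x.1 ∪ x.2)ᶜ := by gcongr
        push_cast
        refine Real.exp_le_exp.2 ?_
        linarith
    _ = _ := by
        rw [sum_const, nsmul_eq_mul, hJ]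
        push_cast
        rfl

/-- Dense small sets are unlikely. -/
lemma prob_exists_dense_le {p : ℝ} (hp0 : 0 < p) (hp1 : p ≤ 1) {M : ℕ} (hM : p * M ≤ 1) :
    prob p (fun G : SimpleGraph V => ∃ k ∈ Icc 1 M, ∃ S : Finset V, #S = k ∧
        4 * #S ≤ cross G S S) ≤
      ∑ k ∈ Icc 1 M, (Fintype.card V).choose k * (Real.exp k * (p * k) ^ (2 * k)) := by
  refine (prob_exists_le hp0.le hp1 _ _).trans (sum_le_sum fun k hk => ?_)
  rw [mem_Icc] at hk
  have hk0 : (0 : ℝ) < k := by exact_mod_cast hk.1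
  have hpk : p * k ≤ 1 := le_trans (by gcongr; exact hk.2) hM
  have hpk0 : 0 < p * k := by positivity
  calc _ ≤ prob p (fun G : SimpleGraph V => ∃ S ∈ powersetCard k univ,
          2 * k ≤ edgeCount (pairsWithin S) G) := by
        refine prob_mono hp0.le hp1 ?_
        rintro G ⟨S, h1, h2⟩
        refine ⟨S, by simp [h1], ?_⟩
        have := cross_self_le G S
        omega
    _ ≤ ∑ S ∈ powersetCard k (univ : Finset V), prob p (fun G : SimpleGraph V =>
          2 * k ≤ edgeCount (pairsWithin S) G) := prob_exists_le hp0.le hp1 _ _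
    _ ≤ ∑ S ∈ powersetCard k (univ : Finset V), Real.exp k * (p * k) ^ (2 * k) := by
        refine sum_le_sum fun S hS => ?_
        rw [mem_powersetCard_univ] at hS
        -- With at most k² pairs, this c keeps the moment below exp k and gains a factor pk per
        -- edge.
        refine (prob_le_edgeCount hp0.le hp1 (c := (p * k)⁻¹) ?_ (pairsWithin_subset S) _).trans ?_
        · exact (one_le_inv₀ hpk0).2 hpk
        rw [inv_pow, div_inv_eq_mul]
        gcongr
        have h1 : (#(pairsWithin S) : ℝ) ≤ k ^ 2 := by
          have := card_pairsWithin_le S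
          rw [hS] at this
          exact_mod_cast this
        calc _ ≤ (p * k)⁻¹ * p * #(pairsWithin S) := by gcongr; linarith
          _ ≤ (p * k)⁻¹ * p * k ^ 2 := by gcongr
          _ = k := by field_simp
    _ = _ := by
        rw [sum_const, nsmul_eq_mul, card_powersetCard, card_univ]

/-- For boundedly many pairs, the choice c = 1/p costs only a constant and gains p per edge. -/
lemma one_add_inv_sub_one_mul_le {p : ℝ} (hp0 : 0 < p) : 1 + (p⁻¹ - 1) * p ≤ 2 := by
  have : p⁻¹ * p = 1 := inv_mul_cancel₀ hp0.ne'
  nlinarith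

/-- A set of five vertices spanning six edges is unlikely when `p` is small. -/
lemma prob_exists_five_six_le {p : ℝ} (hp0 : 0 < p) (hp1 : p ≤ 1) :
    prob p (fun G : SimpleGraph V => ∃ S : Finset V, #S = 5 ∧ 12 ≤ cross G S S) ≤
      (Fintype.card V) ^ 5 * (2 ^ 25 * p ^ 6) := by
  calc _ ≤ prob p (fun G : SimpleGraph V => ∃ S ∈ powersetCard 5 univ,
          6 ≤ edgeCount (pairsWithin S) G) := by
        refine prob_mono hp0.le hp1 ?_
        rintro G ⟨S, h1, h2⟩
        refine ⟨S, by simp [h1], ?_⟩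
        have := cross_self_le G S
        omega
    _ ≤ ∑ S ∈ powersetCard 5 (univ : Finset V), prob p (fun G : SimpleGraph V =>
          6 ≤ edgeCount (pairsWithin S) G) := prob_exists_le hp0.le hp1 _ _
    _ ≤ ∑ S ∈ powersetCard 5 (univ : Finset V), (2 ^ 25 * p ^ 6) := by
        refine sum_le_sum fun S hS => ?_
        rw [mem_powersetCard_univ] at hS
        have h := prob_le_edgeCount_and_edgeCount_le hp0.le hp1 (a := 1) (c := p⁻¹)
          ((one_le_inv₀ hp0).2 hp1) one_pos le_rfl (pairsWithin_subset S) (F := ∅) (by simp)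
          (by simp) 6 0
        refine le_trans (by simpa [edgeCount] using h) ?_
        gcongr
        have h1 := card_pairsWithin_le S
        rw [hS] at h1
        calc _ ≤ (2 : ℝ) ^ #(pairsWithin S) := by
              have : 0 ≤ 1 + (p⁻¹ - 1) * p := by
                have : p⁻¹ * p = 1 := inv_mul_cancel₀ hp0.ne'
                nlinarith
              gcongr
              exact one_add_inv_sub_one_mul_le hp0
          _ ≤ 2 ^ 25 := by gcongr <;> norm_num; exact h1
    _ ≤ _ := by
        rw [sum_const, nsmul_eq_mul, card_powersetCard, card_univ]
        gcongr
        exact_mod_cast Nat.choose_le_pow _ _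

/-- Two vertices of small degree in a common small connected set are unlikely. -/
lemma prob_exists_close_low_le {p : ℝ} (hp0 : 0 < p) (hp1 : p ≤ 1) :
    prob p (fun G : SimpleGraph V => ∃ t ∈ Icc 2 5, ∃ S : Finset V, #S = t ∧
        2 * (#S - 1) ≤ cross G S S ∧ ∃ v ∈ S, ∃ w ∈ S, v ≠ w ∧ G.degree v < 30 ∧
          G.degree w < 30) ≤
      ∑ t ∈ Icc 2 5, (Fintype.card V : ℝ) ^ t * (25 * (2 ^ 25 * p ^ (t - 1) *
        (Real.exp (-(9 / 5 * p * (Fintype.card V - 5))) * 10 ^ 60))) := by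
  set n := Fintype.card V with hn
  refine (prob_exists_le hp0.le hp1 _ _).trans (sum_le_sum fun t ht => ?_)
  rw [mem_Icc] at ht
  let A : Finset V → V × V → SimpleGraph V → Prop := fun S x G =>
    t - 1 ≤ edgeCount (pairsWithin S) G ∧ edgeCount (pairsBetween {x.1, x.2} Sᶜ) G ≤ 60
  calc _ ≤ prob p (fun G : SimpleGraph V => ∃ S ∈ powersetCard t univ,
          ∃ x ∈ S.offDiag, A S x G) := by
        refine prob_mono hp0.le hp1 ?_
        rintro G ⟨S, h1, h2, v, hv, w, hw, hvw, hdv, hdw⟩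
        refine ⟨S, by simp [h1], (v, w), by simp [hv, hw, hvw], ?_, ?_⟩
        · have := cross_self_le G S
          omega
        · have hd : Disjoint {v, w} Sᶜ := by
            refine Disjoint.mono_left (?_ : _ ⊆ S) disjoint_compl_right
            intro a ha
            rw [mem_insert, mem_singleton] at ha
            rcases ha with rfl | rfl <;> assumption
          rw [edgeCount_pairsBetween hd]
          refine (cross_mono subset_rfl (subset_univ _)).trans ?_
          rw [cross_univ_right, sum_pair hvw]
          omega
    _ ≤ ∑ S ∈ powersetCard t (univ : Finset V), ∑ x ∈ S.offDiag, prob p (A S x) := by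
        refine (prob_exists_le hp0.le hp1 _ _).trans (sum_le_sum fun S _ => ?_)
        exact prob_exists_le hp0.le hp1 _ _
    _ ≤ ∑ S ∈ powersetCard t (univ : Finset V), (25 * (2 ^ 25 * p ^ (t - 1) *
          (Real.exp (-(9 / 5 * p * (n - 5))) * 10 ^ 60))) := by
        refine sum_le_sum fun S hS => ?_
        rw [mem_powersetCard_univ] at hS
        have hoff : (#S.offDiag : ℝ) ≤ 25 := by
          rw [offDiag_card, hS]
          exact_mod_cast le_trans (Nat.sub_le _ _) (Nat.mul_le_mul ht.2 ht.2)
        refine (sum_le_card_nsmul _ _ (2 ^ 25 * p ^ (t - 1) *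
          (Real.exp (-(9 / 5 * p * (n - 5))) * 10 ^ 60)) ?_).trans ?_
        · rintro ⟨v, w⟩ hx
          rw [mem_offDiag] at hx
          obtain ⟨hv, hw, hvw⟩ := hx
          simp only at hv hw hvw
          have hd : Disjoint {v, w} Sᶜ := by
            refine Disjoint.mono_left (?_ : _ ⊆ S) disjoint_compl_right
            intro a ha
            rw [mem_insert, mem_singleton] at ha
            rcases ha with rfl | rfl <;> assumption
          -- A small a is essential: two low vertices then cost exp(-1.8pn) up to constants, which
          -- at np = 0.9 log n is n^(-1.62) and beats the factor n left by the tree. With a = 1/2 it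
          -- would not.
          have h := prob_le_edgeCount_and_edgeCount_le hp0.le hp1 (a := 1 / 10) (c := p⁻¹)
            ((one_le_inv₀ hp0).2 hp1) (by norm_num) (by norm_num) (pairsWithin_subset S)
            (pairsBetween_subset hd) (disjoint_pairsWithin_pairsBetween S _) (t - 1) 60
          refine h.trans ?_
          have h1 := card_pairsWithin_le S
          have h2 : #(pairsWithin S) ≤ 25 := by
            rw [hS] at h1
            nlinarith
          have h3 : (1 + (p⁻¹ - 1) * p) ^ #(pairsWithin S) ≤ (2 : ℝ) ^ 25 := by
            calc _ ≤ (2 : ℝ) ^ #(pairsWithin S) := by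
                  have : 0 ≤ 1 + (p⁻¹ - 1) * p := by
                    have : p⁻¹ * p = 1 := inv_mul_cancel₀ hp0.ne'
                    nlinarith
                  gcongr
                  exact one_add_inv_sub_one_mul_le hp0
              _ ≤ 2 ^ 25 := by gcongr; norm_num
          have h4 : (n : ℝ) ≤ 5 + #Sᶜ := by
            have h5 : #S + #Sᶜ = n := card_add_card_compl _
            exact_mod_cast (by omega : n ≤ 5 + #Sᶜ)
          rw [inv_pow, div_inv_eq_mul, card_pairsBetween hd, card_pair hvw, one_div, inv_pow,
            div_inv_eq_mul]
          gcongr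
          push_cast
          have : p * (n - 5) ≤ p * #Sᶜ := by gcongr; linarith
          linarith
        · rw [nsmul_eq_mul]
          gcongr
    _ ≤ _ := by
        rw [sum_const, nsmul_eq_mul, card_powersetCard, card_univ, ← hn]
        gcongr
        exact_mod_cast Nat.choose_le_pow _ _

end

end RandomGraph

/-! ### The library measure, and isolated vertices by the second moment. -/

namespace RandomGraph

open Finset Classical

lemma binomialRandom_eq_ofReal_prob {V : Type*} [Fintype V] (p : unitInterval)
    (S : Set (SimpleGraph V)) :
    SimpleGraph.binomialRandom V p S = ENNReal.ofReal (prob (p : ℝ) (fun G => G ∈ S)) := by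
  have hw : ∀ G : SimpleGraph V, SimpleGraph.binomialRandom V p {G} =
      ENNReal.ofReal (weight (p : ℝ) G) := by
    intro G
    have h1 : weight (p : ℝ) G = (p : ℝ) ^ G.edgeSet.ncard *
        (1 - p : ℝ) ^ ((Nat.card V).choose 2 - G.edgeSet.ncard) := by
      have hsub := SimpleGraph.edgeFinset_mono (le_top : G ≤ ⊤)
      have hc : G.edgeSet.ncard = #G.edgeFinset := by
        rw [← SimpleGraph.coe_edgeFinset, Set.ncard_coe_finset]
      rw [weight, ← prod_sdiff hsub, mul_comm, hc, Nat.card_eq_fintype_card,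
        ← SimpleGraph.card_edgeFinset_top_eq_card_choose_two, ← card_sdiff_of_subset hsub,
        ← prod_const, ← prod_const]
      congr 1
      · refine prod_congr rfl fun e he => ?_
        rw [SimpleGraph.mem_edgeFinset] at he
        simp [he]
      · refine prod_congr rfl fun e he => ?_
        rw [mem_sdiff, SimpleGraph.mem_edgeFinset, SimpleGraph.mem_edgeFinset] at he
        simp [he.2]
    rw [SimpleGraph.binomialRandom_singleton, h1, ENNReal.ofReal_mul (by have := p.2.1; positivity),
      ENNReal.ofReal_pow p.2.1, ENNReal.ofReal_pow (by linarith [p.2.2])]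
    congr 2
    · rw [ENNReal.ofReal_eq_coe_nnreal p.2.1]
      rfl
    · rw [ENNReal.ofReal_eq_coe_nnreal (by linarith [p.2.2])]
      rfl
  have hS : S = ((univ.filter fun G => G ∈ S : Finset (SimpleGraph V)) : Set (SimpleGraph V)) := by
    ext G; simp
  have : MeasurableSingletonClass (SimpleGraph V) := ⟨fun G => by
    have h := SimpleGraph.measurable_edgeSet (measurableSet_singleton G.edgeSet)
    have heq : SimpleGraph.edgeSet ⁻¹' {G.edgeSet} = {G} := by
      ext H; simp
    rwa [heq] at h⟩
  have h2 := MeasureTheory.sum_measure_singleton (μ := SimpleGraph.binomialRandom V p)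
    (s := univ.filter fun G => G ∈ S)
  rw [← hS] at h2
  rw [← h2, prob, ENNReal.ofReal_sum_of_nonneg fun G _ => weight_nonneg p.2.1 p.2.2 G]
  exact sum_congr rfl fun G _ => hw G

variable {V : Type*} [Fintype V]

/-- The pairs containing `v`. -/
noncomputable def star (v : V) : Finset (Sym2 V) := pairsBetween {v} {v}ᶜ

lemma star_subset (v : V) : star v ⊆ (⊤ : SimpleGraph V).edgeFinset :=
  pairsBetween_subset disjoint_compl_right

lemma card_star (v : V) : #(star v) = Fintype.card V - 1 := by
  rw [star, card_pairsBetween disjoint_compl_right, card_compl]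
  simp

lemma edgeCount_star (v : V) (G : SimpleGraph V) : edgeCount (star v) G = G.degree v := by
  rw [star, edgeCount_pairsBetween disjoint_compl_right, ← sum_singleton (fun a => G.degree a) v,
    ← cross_univ_right]
  refine le_antisymm (cross_mono subset_rfl (subset_univ _)) ?_
  rw [← union_compl {v}]
  refine (cross_union_right_le _ _ _ _).trans ?_
  have : cross G {v} {v} = 0 := by
    rw [cross_eq_sum]; simp
  omega

/-- The two stars share only the pair vw, whose double count is the source of the factor 1/(1 - p)
in the pair probability. -/
lemma le_card_star_union {v w : V} (h : v ≠ w) :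
    2 * (Fintype.card V - 1) ≤ #(star v ∪ star w) + 1 := by
  have h1 := card_union_add_card_inter (star v) (star w)
  rw [card_star, card_star] at h1
  have h2 : star v ∩ star w ⊆ {s(v, w)} := by
    intro e he
    simp only [star, pairsBetween, mem_inter, mem_image, mem_product, mem_singleton, mem_compl,
      Prod.exists] at he
    obtain ⟨⟨a, b, ⟨rfl, _⟩, rfl⟩, c, d, ⟨rfl, _⟩, heq⟩ := he
    rw [mem_singleton]
    rcases Sym2.eq_iff.1 heq with ⟨h1, h2⟩ | ⟨h1, h2⟩
    · exact absurd h1.symm h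
    · rw [h1]
  have h3 := card_le_card h2
  rw [card_singleton] at h3
  omega

lemma prob_degree_eq_zero (p : ℝ) (v : V) :
    prob p (fun G : SimpleGraph V => G.degree v = 0) = (1 - p) ^ (Fintype.card V - 1) := by
  rw [← card_star v, ← prob_edgeCount_eq_zero (star_subset v)]
  simp_rw [edgeCount_star]

lemma prob_degree_eq_zero_and_le {p : ℝ} (hp0 : 0 ≤ p) (hp1 : p < 1) {v w : V} (h : v ≠ w) :
    prob p (fun G : SimpleGraph V => G.degree v = 0 ∧ G.degree w = 0) ≤
      (1 - p) ^ (2 * (Fintype.card V - 1)) / (1 - p) := by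
  have h1 : ∀ G : SimpleGraph V, G.degree v = 0 ∧ G.degree w = 0 →
      edgeCount (star v ∪ star w) G = 0 := by
    rintro G ⟨hv, hw⟩
    have h2 := card_union_le {e ∈ star v | e ∈ G.edgeSet} {e ∈ star w | e ∈ G.edgeSet}
    rw [← filter_union] at h2
    change edgeCount (star v ∪ star w) G ≤ edgeCount (star v) G + edgeCount (star w) G at h2
    rw [edgeCount_star, edgeCount_star] at h2
    omega
  refine (prob_mono hp0 hp1.le h1).trans ?_
  rw [prob_edgeCount_eq_zero (union_subset (star_subset v) (star_subset w)),
    le_div_iff₀ (by linarith), ← pow_succ]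
  exact pow_le_pow_of_le_one (by linarith) (by linarith) (le_card_star_union h)

/-- The second moment bound for the absence of isolated vertices. -/
lemma prob_forall_degree_ne_zero_le [Nonempty V] {p : ℝ} (hp0 : 0 ≤ p) (hp1 : p < 1) :
    prob p (fun G : SimpleGraph V => ∀ v, G.degree v ≠ 0) ≤
      1 / (Fintype.card V * (1 - p) ^ (Fintype.card V - 1)) + p / (1 - p) := by
  set n := Fintype.card V with hn
  set q := (1 - p) ^ (n - 1) with hq
  have hp' : 0 < 1 - p := by linarith
  have hq0 : 0 < q := by positivity
  have hn0 : (0 : ℝ) < n := by exact_mod_cast Fintype.card_pos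
  set μ := n * q with hμ
  have hμ0 : 0 < μ := by positivity
  let ι : V → SimpleGraph V → ℝ := fun v G => if G.degree v = 0 then 1 else 0
  have h1 : ∑ G : SimpleGraph V, weight p G * ∑ v, ι v G = μ := by
    simp_rw [mul_sum]
    rw [sum_comm]
    have : ∀ v, ∑ G : SimpleGraph V, weight p G * ι v G = q := by
      intro v
      rw [hq, hn, ← prob_degree_eq_zero p v, prob, sum_filter]
      exact sum_congr rfl fun G _ => by simp [ι]
    simp_rw [this]
    rw [sum_const, card_univ, nsmul_eq_mul]
  have h2 : ∑ G : SimpleGraph V, weight p G * (∑ v, ι v G) ^ 2 ≤ μ + μ ^ 2 / (1 - p) := by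
    -- The second term is kept on the diagonal too, so that the double sum is exact.
    have h3 : ∀ v w, ∑ G : SimpleGraph V, weight p G * (ι v G * ι w G) ≤
        (if v = w then q else 0) + q ^ 2 / (1 - p) := by
      intro v w
      have h4 : ∑ G : SimpleGraph V, weight p G * (ι v G * ι w G) =
          prob p (fun G : SimpleGraph V => G.degree v = 0 ∧ G.degree w = 0) := by
        rw [prob, sum_filter]
        refine sum_congr rfl fun G _ => ?_
        by_cases hv : G.degree v = 0 <;> by_cases hw : G.degree w = 0 <;> simp [ι, hv, hw]
      rw [h4]
      split_ifs with hvw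
      · subst hvw
        simp_rw [and_self]
        rw [prob_degree_eq_zero]
        have : 0 ≤ q ^ 2 / (1 - p) := by positivity
        linarith
      · rw [zero_add, hq, ← pow_mul, mul_comm (n - 1)]
        exact prob_degree_eq_zero_and_le hp0 hp1 hvw
    calc _ = ∑ v, ∑ w, ∑ G : SimpleGraph V, weight p G * (ι v G * ι w G) := by
          simp_rw [sq, sum_mul_sum, mul_sum]
          rw [sum_comm]
          exact sum_congr rfl fun v _ => sum_comm
      _ ≤ ∑ v : V, ∑ w : V, ((if v = w then q else 0) + q ^ 2 / (1 - p)) :=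
          sum_le_sum fun v _ => sum_le_sum fun w _ => h3 v w
      _ = μ + μ ^ 2 / (1 - p) := by
          simp only [sum_add_distrib, sum_ite_eq, mem_univ, if_true, sum_const, card_univ,
            nsmul_eq_mul, hμ, ← hn]
          ring
  -- Chebyshev: this function equals 1 when no vertex is isolated.
  refine (prob_le_sum hp0 hp1.le _ (fun G => (∑ v, ι v G - μ) ^ 2 / μ ^ 2)
    (fun G => by positivity) ?_).trans ?_
  · intro G hG
    have : ∑ v, ι v G = 0 := sum_eq_zero fun v _ => by simp [ι, hG v]
    rw [this, zero_sub, neg_sq, div_self (by positivity)]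
  · have h5 : ∑ G : SimpleGraph V, weight p G * ((∑ v, ι v G - μ) ^ 2 / μ ^ 2) =
        (∑ G : SimpleGraph V, weight p G * (∑ v, ι v G) ^ 2 -
          2 * μ * ∑ G : SimpleGraph V, weight p G * ∑ v, ι v G +
          μ ^ 2 * ∑ G : SimpleGraph V, weight p G) / μ ^ 2 := by
      rw [mul_sum univ _ (2 * μ), mul_sum univ _ (μ ^ 2)]
      rw [← sum_sub_distrib, ← sum_add_distrib, sum_div]
      exact sum_congr rfl fun G _ => by ring
    rw [h5, h1, sum_weight]
    calc _ ≤ (μ + μ ^ 2 / (1 - p) - 2 * μ * μ + μ ^ 2 * 1) / μ ^ 2 := by gcongr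
      _ = _ := by field_simp; ring

end RandomGraph

/-! ### The bounds tend to zero, uniformly in p within each range. -/

namespace RandomGraph

open Finset Filter

lemma tendsto_log_natCast_atTop : Tendsto (fun n : ℕ => Real.log n) atTop atTop :=
  Real.tendsto_log_atTop.comp tendsto_natCast_atTop_atTop

lemma eventually_log_pow_mul_exp_le (k : ℕ) {c ε : ℝ} (hc : 0 < c) (hε : 0 < ε) :
    ∀ᶠ n : ℕ in atTop, Real.log n ^ k * Real.exp (-(c * Real.log n)) ≤ ε := by
  have h := ((isLittleO_pow_exp_pos_mul_atTop k hc).tendsto_div_nhds_zero.comp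
    tendsto_log_natCast_atTop).eventually_le_const hε
  filter_upwards [h] with n hn
  rw [Real.exp_neg, ← div_eq_mul_inv]
  exact hn

lemma eventually_exp_neg_log_le {c ε : ℝ} (hc : 0 < c) (hε : 0 < ε) :
    ∀ᶠ n : ℕ in atTop, Real.exp (-(c * Real.log n)) ≤ ε := by
  simpa using eventually_log_pow_mul_exp_le 0 hc hε

lemma choose_le_div_pow_mul_exp (n : ℕ) {k : ℕ} (hk : 1 ≤ k) :
    (n.choose k : ℝ) ≤ (n / k) ^ k * Real.exp k := by
  have hk0 : (0 : ℝ) < k := by exact_mod_cast hk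
  have h1 : (n.choose k : ℝ) ≤ (n ^ k : ℝ) / (k.factorial : ℝ) := Nat.choose_le_pow_div k n
  have h2 := Real.pow_div_factorial_le_exp (k : ℝ) hk0.le k
  calc (n.choose k : ℝ) ≤ (n ^ k : ℝ) / (k.factorial : ℝ) := h1
    _ = (n / k) ^ k * ((k : ℝ) ^ k / k.factorial) := by rw [div_pow]; field_simp
    _ ≤ _ := by gcongr

/-- Since 1 - p ≥ exp(-p/(1 - p)) and p is at most 1/100, (1 - p)^n ≥ n^(-0.91), so the expected
number of isolated vertices is at least n^0.08. -/
lemma eventually_second_moment_le {ε : ℝ} (hε : 0 < ε) :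
    ∀ᶠ n : ℕ in atTop, ∀ p : ℝ, 0 ≤ p → n * p ≤ 9 / 10 * Real.log n →
      p < 1 ∧ 1 / (n * (1 - p) ^ (n - 1)) + p / (1 - p) ≤ ε := by
  filter_upwards [eventually_log_pow_mul_exp_le 1 one_pos (ε := 1 / 100) (by norm_num),
    eventually_log_pow_mul_exp_le 1 one_pos (ε := ε / 4) (by linarith),
    eventually_exp_neg_log_le (c := 8 / 100) (by norm_num) (ε := ε / 2) (by linarith),
    eventually_ge_atTop 1] with n h1 h2 h3 hn p hp hnp
  have hn0 : (0 : ℝ) < n := by exact_mod_cast hn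
  have hn1 : (1 : ℝ) ≤ n := by exact_mod_cast hn
  have hL : 0 ≤ Real.log n := Real.log_nonneg hn1
  rw [pow_one, one_mul, Real.exp_neg, Real.exp_log hn0, ← div_eq_mul_inv] at h1 h2
  have hp' : p ≤ Real.log n / n := by
    rw [le_div_iff₀ hn0]
    linarith
  have hp1 : p ≤ 1 / 100 := hp'.trans h1
  have hq : 0 < 1 - p := by linarith
  refine ⟨by linarith, ?_⟩
  have h4 : p / (1 - p) ≤ ε / 2 := by
    rw [div_le_iff₀ hq]
    nlinarith [hp'.trans h2]
  have h5 : Real.exp (-(p / (1 - p))) ≤ 1 - p := by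
    have h6 := Real.add_one_le_exp (p / (1 - p))
    have h7 : p / (1 - p) + 1 = (1 - p)⁻¹ := by field_simp; ring
    rw [h7] at h6
    rw [Real.exp_neg]
    exact (inv_le_comm₀ hq (Real.exp_pos _)).1 h6
  have h6 : Real.exp (-(91 / 100 * Real.log n)) ≤ (1 - p) ^ (n - 1) := by
    calc _ ≤ Real.exp (n * -(p / (1 - p))) := by
          refine Real.exp_le_exp.2 ?_
          have : p / (1 - p) ≤ 100 / 99 * p := by
            rw [div_le_iff₀ hq]
            nlinarith
          have : n * (p / (1 - p)) ≤ n * (100 / 99 * p) := by gcongr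
          linarith
      _ = Real.exp (-(p / (1 - p))) ^ n := by rw [Real.exp_nat_mul]
      _ ≤ (1 - p) ^ n := by gcongr
      _ ≤ (1 - p) ^ (n - 1) := pow_le_pow_of_le_one hq.le (by linarith) (Nat.sub_le _ _)
  have h7 : 1 / (n * (1 - p) ^ (n - 1)) ≤ ε / 2 := by
    refine le_trans ?_ h3
    rw [Real.exp_neg, one_div]
    refine inv_anti₀ (Real.exp_pos _) ?_
    calc Real.exp (8 / 100 * Real.log n) ≤
          Real.exp (Real.log n) * Real.exp (-(91 / 100 * Real.log n)) := by
          rw [← Real.exp_add]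
          refine Real.exp_le_exp.2 ?_
          linarith
      _ ≤ _ := by rw [Real.exp_log hn0]; gcongr
  linarith

lemma eventually_minDegree_bound_le {ε : ℝ} (hε : 0 < ε) :
    ∀ᶠ n : ℕ in atTop, ∀ p : ℝ, 9 / 10 * Real.log n ≤ n * p →
      Real.exp (-(n * p * n / 200)) ≤ ε := by
  filter_upwards [eventually_exp_neg_log_le one_pos hε, eventually_ge_atTop 300]
    with n h1 hn p hp
  refine le_trans (Real.exp_le_exp.2 ?_) h1
  have hn1 : (300 : ℝ) ≤ n := by exact_mod_cast hn
  have hL : 0 ≤ Real.log n := Real.log_nonneg (by linarith)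
  have hnp : 0 ≤ n * p := by linarith
  have : 9 / 10 * Real.log n * 300 ≤ n * p * n := by gcongr
  linarith

lemma eventually_large_bound_le {ε : ℝ} (hε : 0 < ε) :
    ∀ᶠ n : ℕ in atTop, ∀ p : ℝ, 9 / 10 * Real.log n ≤ n * p →
      4 ^ n * Real.exp (-(n * p * n / 1600) + 6 / 5 * (n * p) * (7 / 10)) ≤ ε := by
  filter_upwards [eventually_exp_neg_log_le one_pos hε, eventually_ge_atTop 3200,
    tendsto_log_natCast_atTop.eventually_ge_atTop 16000] with n h1 hn hL p hp
  refine le_trans ?_ h1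
  have hn1 : (3200 : ℝ) ≤ n := by exact_mod_cast hn
  have h4 : (4 : ℝ) ^ n ≤ Real.exp (n * 3) := by
    rw [Real.exp_nat_mul]
    gcongr
    linarith [Real.add_one_le_exp (3 : ℝ)]
  have hlog := Real.log_le_self (show (0 : ℝ) ≤ n by linarith)
  calc _ ≤ Real.exp (n * 3) *
        Real.exp (-(n * p * n / 1600) + 6 / 5 * (n * p) * (7 / 10)) := by gcongr
    _ ≤ _ := by
      rw [← Real.exp_add]
      refine Real.exp_le_exp.2 ?_
      nlinarith

/-- Here b ≥ 2 is crucial: 0.84np ≤ 0.42b·np leaves -0.07b·np ≤ -7b log n, against at most 2b log n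
from the binomials. -/
lemma eventually_dense_small_bound_le {ε : ℝ} (hε : 0 < ε) :
    ∀ᶠ n : ℕ in atTop, ∀ p : ℝ, 100 * Real.log n ≤ n * p →
      ∑ b ∈ Icc 2 (n / 100), (n.choose b : ℝ) ^ 2 *
        Real.exp (-(49 / 100 * (b * (n * p))) + 6 / 5 * (n * p) * (7 / 10)) ≤ ε := by
  filter_upwards [eventually_exp_neg_log_le one_pos hε, eventually_ge_atTop 1]
    with n h1 hn p hp
  refine le_trans ?_ h1
  have hn0 : (0 : ℝ) < n := by exact_mod_cast hn
  have hL : 0 ≤ Real.log n := Real.log_nonneg (by exact_mod_cast hn)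
  have hterm : ∀ b ∈ Icc 2 (n / 100), (n.choose b : ℝ) ^ 2 *
      Real.exp (-(49 / 100 * (b * (n * p))) + 6 / 5 * (n * p) * (7 / 10)) ≤
      Real.exp (-(2 * Real.log n)) := by
    intro b hb
    rw [mem_Icc] at hb
    have hb2 : (2 : ℝ) ≤ b := by exact_mod_cast hb.1
    have hc : (n.choose b : ℝ) ≤ Real.exp (b * Real.log n) := by
      rw [Real.exp_nat_mul, Real.exp_log hn0]
      exact_mod_cast Nat.choose_le_pow n b
    calc _ ≤ Real.exp (b * Real.log n) ^ 2 *
          Real.exp (-(49 / 100 * (b * (n * p))) + 6 / 5 * (n * p) * (7 / 10)) := by gcongr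
      _ ≤ _ := by
        rw [← Real.exp_nat_mul, ← Real.exp_add]
        refine Real.exp_le_exp.2 ?_
        push_cast
        have h3 : 2 * (n * p) ≤ b * (n * p) := by
          gcongr
          linarith
        have h4 : (b : ℝ) * (100 * Real.log n) ≤ b * (n * p) := by gcongr
        have h5 : 2 * Real.log n ≤ b * Real.log n := by gcongr
        linarith
  refine (sum_le_card_nsmul _ _ _ hterm).trans ?_
  rw [nsmul_eq_mul]
  have hcard : (#(Icc 2 (n / 100)) : ℝ) ≤ Real.exp (Real.log n) := by
    rw [Real.exp_log hn0, Nat.card_Icc]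
    exact_mod_cast (by omega : n / 100 + 1 - 2 ≤ n)
  calc _ ≤ Real.exp (Real.log n) * Real.exp (-(2 * Real.log n)) := by gcongr
    _ = _ := by rw [← Real.exp_add]; congr 1; ring

/-- For b ≥ n^0.85 the binomials cost only b(2 + 0.3 log n), less than the roughly 0.44b log n
gained from np ≥ 0.9 log n. -/
lemma eventually_sparse_small_bound_le {ε : ℝ} (hε : 0 < ε) :
    ∀ᶠ n : ℕ in atTop, ∀ p : ℝ, 9 / 10 * Real.log n ≤ n * p →
      ∑ b ∈ Icc 2 (n / 100) with 85 / 100 * Real.log n ≤ Real.log (b : ℕ),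
        (n.choose b : ℝ) ^ 2 *
          Real.exp (-(49 / 100 * (b * (n * p))) + 6 / 5 * (n * p) * (7 / 10)) ≤ ε := by
  filter_upwards [eventually_exp_neg_log_le one_pos hε, eventually_ge_atTop 1,
    tendsto_log_natCast_atTop.eventually_ge_atTop 200] with n h1 hn hL p hp
  refine le_trans ?_ h1
  have hn0 : (0 : ℝ) < n := by exact_mod_cast hn
  have hterm : ∀ b ∈ (Icc 2 (n / 100)).filter
      (fun b : ℕ => 85 / 100 * Real.log n ≤ Real.log b),
      (n.choose b : ℝ) ^ 2 *
        Real.exp (-(49 / 100 * (b * (n * p))) + 6 / 5 * (n * p) * (7 / 10)) ≤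
      Real.exp (-(2 * Real.log n)) := by
    intro b hb
    rw [mem_filter, mem_Icc] at hb
    obtain ⟨⟨hb2, hb3⟩, hb4⟩ := hb
    have hb0 : (0 : ℝ) < b := by exact_mod_cast (by omega : 0 < b)
    have hb100 : (100 : ℝ) ≤ b := by
      have := Real.log_le_sub_one_of_pos hb0
      linarith
    have hc : (n.choose b : ℝ) ≤ Real.exp (b * (1 + 15 / 100 * Real.log n)) := by
      refine (choose_le_div_pow_mul_exp n (by omega)).trans ?_
      have h2 : (n : ℝ) / b = Real.exp (Real.log n - Real.log b) := by
        rw [Real.exp_sub, Real.exp_log hn0, Real.exp_log hb0]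
      rw [h2, ← Real.exp_nat_mul, ← Real.exp_add]
      refine Real.exp_le_exp.2 ?_
      have : (b : ℝ) * (Real.log n - Real.log b) ≤ b * (15 / 100 * Real.log n) := by
        gcongr
        linarith
      linarith
    calc _ ≤ Real.exp (b * (1 + 15 / 100 * Real.log n)) ^ 2 *
          Real.exp (-(49 / 100 * (b * (n * p))) + 6 / 5 * (n * p) * (7 / 10)) := by gcongr
      _ ≤ _ := by
        rw [← Real.exp_nat_mul, ← Real.exp_add]
        refine Real.exp_le_exp.2 ?_
        push_cast
        have h3 : 100 * (n * p) ≤ b * (n * p) := by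
          gcongr
          linarith
        have h4 : (b : ℝ) * (9 / 10 * Real.log n) ≤ b * (n * p) := by gcongr
        have h5 : 100 * Real.log n ≤ b * Real.log n := by gcongr
        have h6 : (b : ℝ) * 200 ≤ b * Real.log n := by gcongr
        linarith
  refine (sum_le_card_nsmul _ _ _ hterm).trans ?_
  rw [nsmul_eq_mul]
  have hcard : (#{b ∈ Icc 2 (n / 100) | 85 / 100 * Real.log n ≤ Real.log (b : ℕ)} : ℝ) ≤
      Real.exp (Real.log n) := by
    have h2 := card_filter_le (Icc 2 (n / 100))
      (fun b : ℕ => 85 / 100 * Real.log n ≤ Real.log (b : ℕ))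
    rw [Nat.card_Icc] at h2
    rw [Real.exp_log hn0]
    exact_mod_cast (by omega : _ ≤ n)
  calc _ ≤ Real.exp (Real.log n) * Real.exp (-(2 * Real.log n)) := by gcongr
    _ = _ := by rw [← Real.exp_add]; congr 1; ring

lemma sum_Icc_pow_le {x : ℝ} (hx0 : 0 ≤ x) (hx : x ≤ 1 / 2) (M : ℕ) :
    ∑ k ∈ Icc 1 M, x ^ k ≤ 2 * x := by
  have h : ∀ M : ℕ, ∑ k ∈ Icc 1 M, x ^ k ≤ 2 * x - 2 * x ^ (M + 1) := by
    intro M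
    induction M with
    | zero => simp
    | succ M ih =>
      rw [sum_Icc_succ_top (by omega), pow_succ x (M + 1)]
      nlinarith [mul_nonneg (pow_nonneg hx0 (M + 1)) (by linarith : 0 ≤ 1 - 2 * x)]
  linarith [h M, pow_nonneg hx0 (M + 1)]

/-- The k-th term is at most (e²(np)²k/n)^k, and k/n ≤ 3n^(-0.15), so the sum is dominated by a
geometric series. The 3 matches the sets of size up to 3|B| in `false_of_small_separation`. -/
lemma eventually_local_density_bound_le {ε : ℝ} (hε : 0 < ε) :
    ∀ᶠ n : ℕ in atTop, ∀ p : ℝ, 0 ≤ p → n * p ≤ 100 * Real.log n → ∀ M : ℕ,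
      (M : ℝ) ≤ 3 * Real.exp (85 / 100 * Real.log n) → p * M ≤ 1 ∧
        ∑ k ∈ Icc 1 M, n.choose k * (Real.exp k * (p * k) ^ (2 * k)) ≤ ε := by
  filter_upwards [eventually_log_pow_mul_exp_le 1 (c := 15 / 100) (by norm_num) (ε := 1 / 300)
      (by norm_num),
    eventually_log_pow_mul_exp_le 2 (c := 15 / 100) (by norm_num)
      (ε := 1 / 2 / (30000 * Real.exp 2)) (by positivity),
    eventually_log_pow_mul_exp_le 2 (c := 15 / 100) (by norm_num)
      (ε := ε / 2 / (30000 * Real.exp 2)) (by positivity),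
    eventually_ge_atTop 1] with n h1 h2 h3 hn p hp hnp M hM
  have hn0 : (0 : ℝ) < n := by exact_mod_cast hn
  have hL : 0 ≤ Real.log n := Real.log_nonneg (by exact_mod_cast hn)
  set L := Real.log n with hLdef
  have hnL : (n : ℝ) = Real.exp L := (Real.exp_log hn0).symm
  have hMn : (M : ℝ) / n ≤ 3 * Real.exp (-(15 / 100 * L)) := by
    rw [div_le_iff₀ hn0, hnL, mul_assoc, ← Real.exp_add]
    refine hM.trans (le_of_eq ?_)
    congr 2
    ring
  rw [le_div_iff₀ (by positivity)] at h2 h3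
  rw [pow_one] at h1
  constructor
  · calc p * M = (n * p) * (M / n) := by field_simp
      _ ≤ (100 * L) * (3 * Real.exp (-(15 / 100 * L))) := by gcongr
      _ ≤ 1 := by linarith
  · set x := 30000 * Real.exp 2 * (L ^ 2 * Real.exp (-(15 / 100 * L))) with hx
    have hx0 : 0 ≤ x := by positivity
    refine le_trans (sum_le_sum (g := fun k => x ^ k) ?_)
      ((sum_Icc_pow_le hx0 (by linarith) M).trans (by linarith))
    intro k hk
    rw [mem_Icc] at hk
    have hk0 : (0 : ℝ) < k := by exact_mod_cast hk.1
    have hkM : (k : ℝ) ≤ M := by exact_mod_cast hk.2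
    have hexp : Real.exp k = Real.exp 1 ^ k := by rw [← Real.exp_nat_mul, mul_one]
    calc _ ≤ (n / k) ^ k * Real.exp k * (Real.exp k * (p * k) ^ (2 * k)) := by
          gcongr
          exact choose_le_div_pow_mul_exp n hk.1
      _ = (Real.exp 1 * Real.exp 1 * ((n * p) ^ 2 * (k / n))) ^ k := by
          rw [hexp, pow_mul, ← mul_pow, ← mul_pow, ← mul_pow]
          congr 1
          field_simp
      _ ≤ x ^ k := by
          refine pow_le_pow_left₀ (by positivity) ?_ k
          rw [← Real.exp_add, hx]
          calc _ ≤ Real.exp (1 + 1) * ((100 * L) ^ 2 * (3 * Real.exp (-(15 / 100 * L)))) := by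
                have : (k : ℝ) / n ≤ 3 * Real.exp (-(15 / 100 * L)) :=
                  le_trans (by gcongr) hMn
                gcongr
            _ = _ := by norm_num; ring

lemma eventually_codegree_bound_le {ε : ℝ} (hε : 0 < ε) :
    ∀ᶠ n : ℕ in atTop, ∀ p : ℝ, 0 ≤ p → n * p ≤ 100 * Real.log n →
      (n : ℝ) ^ 5 * (2 ^ 25 * p ^ 6) ≤ ε := by
  filter_upwards [eventually_log_pow_mul_exp_le 6 one_pos (ε := ε / (2 ^ 25 * 100 ^ 6))
    (by positivity), eventually_ge_atTop 1] with n h1 hn p hp hnp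
  have hn0 : (0 : ℝ) < n := by exact_mod_cast hn
  rw [le_div_iff₀ (by positivity), one_mul, Real.exp_neg, Real.exp_log hn0] at h1
  calc (n : ℝ) ^ 5 * (2 ^ 25 * p ^ 6) = 2 ^ 25 * (n * p) ^ 6 * (n : ℝ)⁻¹ := by field_simp
    _ ≤ 2 ^ 25 * (100 * Real.log n) ^ 6 * (n : ℝ)⁻¹ := by gcongr
    _ ≤ ε := by refine le_trans (le_of_eq ?_) h1; ring

/-- Each term is n(np)^(t-1) n^(-1.62) up to a constant, that is n^(-0.62) times at most (log n)^4.
-/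
lemma eventually_close_low_bound_le {ε : ℝ} (hε : 0 < ε) :
    ∀ᶠ n : ℕ in atTop, ∀ p : ℝ, 0 ≤ p → p ≤ 1 → 9 / 10 * Real.log n ≤ n * p →
      n * p ≤ 100 * Real.log n →
      ∑ t ∈ Icc 2 5, (n : ℝ) ^ t * (25 * (2 ^ 25 * p ^ (t - 1) *
        (Real.exp (-(9 / 5 * p * (n - 5))) * 10 ^ 60))) ≤ ε := by
  filter_upwards [eventually_log_pow_mul_exp_le 4 (c := 62 / 100) (by norm_num)
    (ε := ε / 4 / (25 * 2 ^ 25 * 100 ^ 4 * Real.exp 9 * 10 ^ 60)) (by positivity),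
    eventually_ge_atTop 1, tendsto_log_natCast_atTop.eventually_ge_atTop 2]
    with n h1 hn hL p hp hp1 hnp hnp'
  have hn0 : (0 : ℝ) < n := by exact_mod_cast hn
  rw [le_div_iff₀ (by positivity)] at h1
  refine (sum_le_card_nsmul _ _ (ε / 4) ?_).trans (le_of_eq (by simp; ring))
  intro t ht
  rw [mem_Icc] at ht
  obtain ⟨s, rfl⟩ : ∃ s, t = s + 1 := ⟨t - 1, by omega⟩
  rw [Nat.add_sub_cancel]
  have hexp : Real.exp (-(9 / 5 * p * (n - 5))) ≤
      Real.exp 9 * Real.exp (-(162 / 100 * Real.log n)) := by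
    rw [← Real.exp_add]
    refine Real.exp_le_exp.2 ?_
    linarith
  have hpow : (n * p) ^ s ≤ (100 * Real.log n) ^ 4 := by
    calc (n * p) ^ s ≤ (100 * Real.log n) ^ s := by gcongr
      _ ≤ _ := pow_le_pow_right₀ (by linarith) (by omega)
  have hn' : (n : ℝ) * Real.exp (-(162 / 100 * Real.log n)) =
      Real.exp (-(62 / 100 * Real.log n)) := by
    nth_rw 1 [← Real.exp_log hn0]
    rw [← Real.exp_add]
    congr 1
    ring
  calc (n : ℝ) ^ (s + 1) * (25 * (2 ^ 25 * p ^ s *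
        (Real.exp (-(9 / 5 * p * (n - 5))) * 10 ^ 60)))
      = 25 * 2 ^ 25 * 10 ^ 60 * n * (n * p) ^ s * Real.exp (-(9 / 5 * p * (n - 5))) := by
        rw [mul_pow]; ring
    _ ≤ 25 * 2 ^ 25 * 10 ^ 60 * n * (100 * Real.log n) ^ 4 *
        (Real.exp 9 * Real.exp (-(162 / 100 * Real.log n))) := by gcongr
    _ = 25 * 2 ^ 25 * 10 ^ 60 * (100 * Real.log n) ^ 4 * Real.exp 9 *
        (n * Real.exp (-(162 / 100 * Real.log n))) := by ring
    _ ≤ ε / 4 := by rw [hn']; refine le_trans (le_of_eq ?_) h1; ring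

end RandomGraph

/-! ### Exceptional configurations, and assembly of the three ranges of p. -/

namespace RandomGraph

open Finset Classical Filter

section Deterministic

variable {V : Type*}

lemma one_le_card_filter_adj {G : SimpleGraph V} {S : Finset V} {a b : V} (hb : b ∈ S)
    (h : G.Adj a b) : 1 ≤ #{x ∈ S | G.Adj a x} :=
  card_pos.2 ⟨b, mem_filter.2 ⟨hb, h⟩⟩

lemma two_le_card_filter_adj {G : SimpleGraph V} {S : Finset V} {a b c : V} (hb : b ∈ S)
    (hc : c ∈ S) (hbc : b ≠ c) (h : G.Adj a b) (h' : G.Adj a c) : 2 ≤ #{x ∈ S | G.Adj a x} :=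
  one_lt_card.2 ⟨b, mem_filter.2 ⟨hb, h⟩, c, mem_filter.2 ⟨hc, h'⟩, hbc⟩

/-- Three common neighbours give a K_{2,3}, with five vertices and six edges. -/
lemma exists_five_of_three_le_codegree [Fintype V] {G : SimpleGraph V} {v w : V} (hvw : v ≠ w)
    (h : 3 ≤ #{x | G.Adj v x ∧ G.Adj w x}) : ∃ S : Finset V, #S = 5 ∧ 12 ≤ cross G S S := by
  obtain ⟨T, hT, hT3⟩ := exists_subset_card_eq h
  have hadj : ∀ x ∈ T, G.Adj v x ∧ G.Adj w x := fun x hx => by simpa using hT hx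
  have hd : Disjoint {v, w} T := by
    rw [disjoint_left]
    intro a ha haT
    rw [mem_insert, mem_singleton] at ha
    rcases ha with rfl | rfl
    · exact G.irrefl (hadj _ haT).1
    · exact G.irrefl (hadj _ haT).2
  refine ⟨{v, w} ∪ T, by rw [card_union_of_disjoint hd, card_pair hvw, hT3], ?_⟩
  rw [cross_eq_sum, sum_union hd, sum_pair hvw]
  have h1 : ∀ a, (∀ x ∈ T, G.Adj a x) → 3 ≤ #{b ∈ {v, w} ∪ T | G.Adj a b} := fun a ha => by
    rw [← hT3]
    exact card_le_card fun x hx => mem_filter.2 ⟨mem_union_right _ hx, ha x hx⟩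
  have h2 : #T • 2 ≤ ∑ a ∈ T, #{b ∈ {v, w} ∪ T | G.Adj a b} :=
    card_nsmul_le_sum _ _ _ fun x hx => two_le_card_filter_adj (by simp) (by simp) hvw
      (hadj x hx).1.symm (hadj x hx).2.symm
  have h3 := h1 v fun x hx => (hadj x hx).1
  have h4 := h1 w fun x hx => (hadj x hx).2
  rw [hT3, smul_eq_mul] at h2
  omega

/-- A vertex set of size at most five, with at least as many edges as a spanning tree, that
contains two vertices of small degree. -/
def HasCloseLow [Fintype V] (G : SimpleGraph V) : Prop :=
  ∃ t ∈ Icc 2 5, ∃ S : Finset V, #S = t ∧ 2 * (#S - 1) ≤ cross G S S ∧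
    ∃ v ∈ S, ∃ w ∈ S, v ≠ w ∧ G.degree v < 30 ∧ G.degree w < 30

variable [Fintype V] {G : SimpleGraph V} {v w : V}

lemma hasCloseLow_of_adj (hvw : v ≠ w) (hv : G.degree v < 30) (hw : G.degree w < 30)
    (h : G.Adj v w) : HasCloseLow G := by
  have hc : #{v, w} = 2 := card_pair hvw
  refine ⟨2, by simp, {v, w}, hc, ?_, v, by simp, w, by simp, hvw, hv, hw⟩
  rw [hc, cross_eq_sum, sum_pair hvw]
  have h1 := one_le_card_filter_adj (S := {v, w}) (by simp) h
  have h2 := one_le_card_filter_adj (S := {v, w}) (by simp) h.symm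
  omega

lemma hasCloseLow_of_adj_adj (hvw : v ≠ w) (hv : G.degree v < 30) (hw : G.degree w < 30)
    {x : V} (h : G.Adj v x) (h' : G.Adj x w) : HasCloseLow G := by
  have hx : v ∉ ({x, w} : Finset V) := by simp [h.ne, hvw]
  have hc : #{v, x, w} = 3 := by rw [card_insert_of_notMem hx, card_pair h'.ne]
  refine ⟨3, by simp, {v, x, w}, hc, ?_, v, by simp, w, by simp, hvw, hv, hw⟩
  rw [hc, cross_eq_sum, sum_insert hx, sum_pair h'.ne]
  have h1 := one_le_card_filter_adj (S := {v, x, w}) (by simp) h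
  have h2 := two_le_card_filter_adj (S := {v, x, w}) (by simp) (by simp) hvw h.symm h'
  have h3 := one_le_card_filter_adj (S := {v, x, w}) (by simp) h'.symm
  omega

lemma hasCloseLow_of_path (hvw : v ≠ w) (hv : G.degree v < 30) (hw : G.degree w < 30)
    {x y z : V} (hyv : y ≠ v) (hyw : y ≠ w) (hxz : x ≠ z) (h₁ : G.Adj v x) (h₂ : G.Adj x y)
    (h₃ : G.Adj y z) (h₄ : G.Adj z w) : HasCloseLow G := by
  by_cases hxw : x = w
  · exact hasCloseLow_of_adj hvw hv hw (hxw ▸ h₁)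
  by_cases hzv : z = v
  · exact hasCloseLow_of_adj hvw hv hw (hzv ▸ h₄)
  have e1 : v ∉ ({x, y, z, w} : Finset V) := by simp [h₁.ne, hyv.symm, Ne.symm hzv, hvw]
  have e2 : x ∉ ({y, z, w} : Finset V) := by simp [h₂.ne, hxz, hxw]
  have e3 : y ∉ ({z, w} : Finset V) := by simp [h₃.ne, hyw]
  have hc : #{v, x, y, z, w} = 5 := by
    rw [card_insert_of_notMem e1, card_insert_of_notMem e2, card_insert_of_notMem e3,
      card_pair h₄.ne]
  refine ⟨5, by simp, {v, x, y, z, w}, hc, ?_, v, by simp, w, by simp, hvw, hv, hw⟩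
  rw [hc, cross_eq_sum, sum_insert e1, sum_insert e2, sum_insert e3, sum_pair h₄.ne]
  have r1 := one_le_card_filter_adj (S := {v, x, y, z, w}) (by simp) h₁
  have r2 := two_le_card_filter_adj (S := {v, x, y, z, w}) (by simp) (by simp) hyv.symm h₁.symm h₂
  have r3 := two_le_card_filter_adj (S := {v, x, y, z, w}) (by simp) (by simp) hxz h₂.symm h₃
  have r4 := two_le_card_filter_adj (S := {v, x, y, z, w}) (by simp) (by simp) hyw h₃.symm h₄
  have r5 := one_le_card_filter_adj (S := {v, x, y, z, w}) (by simp) h₄.symm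
  omega

/-- Padding U to size exactly |B| only shrinks R, and lets the union bound run over one size
parameter. -/
lemma exists_cross_compl_union_le {U B R : Finset V} (hUB : Disjoint U B)
    (huniv : U ∪ B ∪ R = univ) (hcard : #U ≤ #B) (hB : 2 * #B ≤ Fintype.card V) :
    ∃ U' : Finset V, Disjoint B U' ∧ #U' = #B ∧ cross G B (B ∪ U')ᶜ ≤ cross G B R := by
  have h1 : U ⊆ Bᶜ := fun a ha => mem_compl.2 (disjoint_left.1 hUB ha)
  have h2 : #B ≤ #Bᶜ := by
    have := card_add_card_compl B
    omega
  obtain ⟨U', hU, hU', hc⟩ := exists_subsuperset_card_eq h1 hcard h2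
  refine ⟨U', ?_, hc, cross_mono subset_rfl ?_⟩
  · rw [disjoint_left]
    exact fun a ha ha' => mem_compl.1 (hU' ha') ha
  · intro a ha
    have := mem_univ a
    rw [← huniv] at this
    simp only [mem_union, mem_compl, not_or] at ha this
    rcases this with (h | h) | h
    · exact absurd (hU h) ha.2
    · exact absurd h ha.1
    · exact h

/-- In a graph without sparse cuts between large sets, a difference between resilience and minimum
degree is witnessed by a separation with a small side. -/
lemma exists_small_separation [Nonempty V] (hV : Even (Fintype.card V))
    (h : globalResilience G HasPerfectMatching ≠ G.minDegree) {y : ℝ} (hy : G.minDegree ≤ y)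
    (hlarge : ¬ ∃ x : Finset V × Finset V, Disjoint x.1 x.2 ∧ Fintype.card V ≤ 100 * #x.1 ∧
      Fintype.card V ≤ 8 * #x.2 ∧ (cross G x.1 x.2 : ℝ) ≤ y) :
    ∃ U B R : Finset V, Disjoint U B ∧ U ∪ B ∪ R = univ ∧ #U < #B ∧
      100 * #B < Fintype.card V ∧ cross G B R < G.minDegree ∧
      ∃ x : Finset V × Finset V, Disjoint x.1 x.2 ∧ #x.1 = #B ∧ #x.2 = #B ∧
        (cross G x.1 (x.1 ∪ x.2)ᶜ : ℝ) ≤ y := by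
  obtain ⟨U, B, R, hUB, -, hBR, huniv, hcross, hR, hcase⟩ :=
    exists_separation_of_globalResilience_ne hV h
  have hcy : (cross G B R : ℝ) ≤ y := le_trans (by exact_mod_cast hcross.le) hy
  have hB : 100 * #B < Fintype.card V := by
    by_contra! hB
    exact hlarge ⟨(B, R), hBR, hB, hR, hcy⟩
  have hUBc : #U < #B := by omega
  obtain ⟨U', hd, hc, hle⟩ := exists_cross_compl_union_le (G := G) hUB huniv hUBc.le (by omega)
  exact ⟨U, B, R, hUB, huniv, hUBc, hB, hcross, (B, U'), hd, rfl, hc,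
    le_trans (by exact_mod_cast hle) hcy⟩

/-- If |B| = 1 then U is empty and all edges at B go to R. This supplies the b ≥ 2 required by the
union bounds. -/
lemma two_le_card_of_cross_lt_minDegree {U B R : Finset V}
    (huniv : U ∪ B ∪ R = univ) (hcard : #U < #B) (hcross : cross G B R < G.minDegree) :
    2 ≤ #B := by
  by_contra! hB
  have hU : U = ∅ := by rw [← card_eq_zero]; omega
  obtain ⟨v, rfl⟩ := card_eq_one.1 (by omega : #B = 1)
  have h1 := card_mul_le_cross_univ (G := G) (A := {v}) fun v _ => G.minDegree_le_degree v
  rw [← huniv, hU, empty_union] at h1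
  have h2 := cross_union_right_le G {v} {v} R
  have h3 : cross G {v} {v} = 0 := by
    rw [cross_eq_sum]; simp
  rw [card_singleton, one_mul] at h1
  omega

end Deterministic

section Asymptotics

lemma eventually_prob_le_of_log_le {ε : ℝ} (hε : 0 < ε) :
    ∀ᶠ n : ℕ in atTop, Even n → ∀ p : ℝ, 0 ≤ p → p ≤ 1 → n * p ≤ 9 / 10 * Real.log n →
      prob p (fun G : SimpleGraph (Fin n) =>
        globalResilience G HasPerfectMatching ≠ G.minDegree) ≤ ε := by
  filter_upwards [eventually_second_moment_le hε, eventually_ge_atTop 1]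
    with n h1 hn _ p hp0 hp1 hnp
  have : Nonempty (Fin n) := ⟨⟨0, hn⟩⟩
  obtain ⟨hp, h2⟩ := h1 p hp0 hnp
  refine le_trans (prob_mono hp0 hp1 ?_) ((prob_forall_degree_ne_zero_le (V := Fin n) hp0 hp).trans
    (by simpa using h2))
  -- An isolated vertex forces both resilience and minimum degree to be 0.
  intro G hG v hv
  have h3 := globalResilience_le_degree G v
  have h4 := G.minDegree_le_degree v
  omega

lemma eventually_prob_le_of_dense {ε : ℝ} (hε : 0 < ε) :
    ∀ᶠ n : ℕ in atTop, Even n → ∀ p : ℝ, 0 ≤ p → p ≤ 1 → 100 * Real.log n ≤ n * p →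
      prob p (fun G : SimpleGraph (Fin n) =>
        globalResilience G HasPerfectMatching ≠ G.minDegree) ≤ ε := by
  filter_upwards [eventually_minDegree_bound_le (ε := ε / 3) (by linarith),
    eventually_large_bound_le (ε := ε / 3) (by linarith),
    eventually_dense_small_bound_le (ε := ε / 3) (by linarith), eventually_ge_atTop 1]
    with n h1 h2 h3 hn hnE p hp0 hp1 hnp
  have : Nonempty (Fin n) := ⟨⟨0, hn⟩⟩
  have hL : 0 ≤ Real.log n := Real.log_nonneg (by exact_mod_cast hn)
  have hy : 0 ≤ 6 / 5 * (n * p) := by positivity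
  have e1 := prob_lt_minDegree_le (V := Fin n) hp0 hp1
  have e2 := prob_exists_large_cross_le (V := Fin n) hp0 hp1 hy
  have e3 := prob_exists_small_cross_le (V := Fin n) hp0 hp1 hy (Icc 2 (n / 100))
    (by intro b hb; rw [mem_Icc] at hb; rw [Fintype.card_fin]; omega)
  rw [Fintype.card_fin] at e1 e2 e3
  have e1' := e1.trans (h1 p (by linarith))
  have e2' := e2.trans (h2 p (by linarith))
  have e3' := e3.trans (h3 p hnp)
  refine le_trans (prob_mono hp0 hp1 ?_) ((prob_or_le hp0 hp1 _ _).trans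
    ((add_le_add e1' ((prob_or_le hp0 hp1 _ _).trans (add_le_add e2' e3'))).trans
      (by linarith)))
  intro G hG
  by_contra! hno
  obtain ⟨n1, n2, n3⟩ := hno
  obtain ⟨U, B, R, hUB, huniv, hcard, hB, hcross, x, hx⟩ :=
    exists_small_separation (by simpa using hnE) hG (y := 6 / 5 * (n * p)) n1 (by
      rintro ⟨x, hx1, hx2, hx3, hx4⟩
      rw [Fintype.card_fin] at hx2 hx3
      exact absurd hx4 (not_le.2 (n2 x hx1 hx2 hx3)))
  rw [Fintype.card_fin] at hB
  have hB2 := two_le_card_of_cross_lt_minDegree huniv hcard hcross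
  exact absurd hx.2.2.2 (not_le.2 (n3 #B (mem_Icc.2 ⟨hB2, by omega⟩) x hx.1 hx.2.1 hx.2.2.1))

lemma eventually_prob_le_of_sparse {ε : ℝ} (hε : 0 < ε) :
    ∀ᶠ n : ℕ in atTop, Even n → ∀ p : ℝ, 0 ≤ p → p ≤ 1 → 9 / 10 * Real.log n ≤ n * p →
      n * p ≤ 100 * Real.log n →
      prob p (fun G : SimpleGraph (Fin n) =>
        globalResilience G HasPerfectMatching ≠ G.minDegree) ≤ ε := by
  filter_upwards [eventually_minDegree_bound_le (ε := ε / 6) (by linarith),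
    eventually_large_bound_le (ε := ε / 6) (by linarith),
    eventually_sparse_small_bound_le (ε := ε / 6) (by linarith),
    eventually_local_density_bound_le (ε := ε / 6) (by linarith),
    eventually_codegree_bound_le (ε := ε / 6) (by linarith),
    eventually_close_low_bound_le (ε := ε / 6) (by linarith), eventually_ge_atTop 2]
    with n h1 h2 h3 h4 h5 h6 hn hnE p hp0 hp1 hnp hnp'
  have : Nonempty (Fin n) := ⟨⟨0, by omega⟩⟩
  have hn1 : (1 : ℝ) < n := by exact_mod_cast hn
  have hL : 0 < Real.log n := Real.log_pos hn1
  have hp : 0 < p := by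
    by_contra! h
    nlinarith
  have hy : 0 ≤ 6 / 5 * (n * p) := by positivity
  set M := ⌊3 * Real.exp (85 / 100 * Real.log n)⌋₊ with hM
  obtain ⟨hpM, h4'⟩ := h4 p hp0 hnp' M (Nat.floor_le (by positivity))
  have e1 := prob_lt_minDegree_le (V := Fin n) hp0 hp1
  have e2 := prob_exists_large_cross_le (V := Fin n) hp0 hp1 hy
  have e3 := prob_exists_small_cross_le (V := Fin n) hp0 hp1 hy
    ((Icc 2 (n / 100)).filter fun b : ℕ => 85 / 100 * Real.log n ≤ Real.log b)
    (by intro b hb; rw [mem_filter, mem_Icc] at hb; rw [Fintype.card_fin]; omega)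
  have e4 := prob_exists_dense_le (V := Fin n) hp hp1 hpM
  have e5 := prob_exists_five_six_le (V := Fin n) hp hp1
  have e6 : prob p (fun G : SimpleGraph (Fin n) => HasCloseLow G) ≤ _ :=
    prob_exists_close_low_le (V := Fin n) hp hp1
  rw [Fintype.card_fin] at e1 e2 e3 e4 e5 e6
  have e1' := e1.trans (h1 p hnp)
  have e2' := e2.trans (h2 p hnp)
  have e3' := e3.trans (h3 p hnp)
  have e4' := e4.trans h4'
  have e5' := e5.trans (h5 p hp0 hnp')
  have e6' := e6.trans (h6 p hp0 hp1 hnp hnp')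
  refine le_trans (prob_mono hp0 hp1 ?_) ((prob_or_le hp0 hp1 _ _).trans
    ((add_le_add e1' ((prob_or_le hp0 hp1 _ _).trans
      (add_le_add e2' ((prob_or_le hp0 hp1 _ _).trans
        (add_le_add e3' ((prob_or_le hp0 hp1 _ _).trans
          (add_le_add e4' ((prob_or_le hp0 hp1 _ _).trans (add_le_add e5' e6'))))))))).trans
      (by linarith)))
  intro G hG
  by_contra hno
  rw [not_or, not_or, not_or, not_or, not_or] at hno
  obtain ⟨n1, n2, n3, n4, n5, n6⟩ := hno
  obtain ⟨U, B, R, hUB, huniv, hcard, hB, hcross, x, hx⟩ :=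
    exists_small_separation (by simpa using hnE) hG (y := 6 / 5 * (n * p)) (not_lt.1 n1)
      (by rw [Fintype.card_fin]; exact n2)
  rw [Fintype.card_fin] at hB
  have hB2 := two_le_card_of_cross_lt_minDegree huniv hcard hcross
  -- Above n^0.85 the union bound excludes B; below, the local structure does.
  by_cases hlog : 85 / 100 * Real.log n ≤ Real.log (#B : ℕ)
  · exact n3 ⟨#B, mem_filter.2 ⟨mem_Icc.2 ⟨hB2, by omega⟩, hlog⟩, x, hx⟩
  · have hB0 : (0 : ℝ) < #B := by exact_mod_cast (by omega : 0 < #B)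
    have hBM : 3 * #B ≤ M := by
      rw [hM, Nat.le_floor_iff (by positivity)]
      push_cast
      gcongr
      exact (Real.log_le_iff_le_exp hB0).1 (not_le.1 hlog).le
    refine false_of_small_separation (by omega) (fun v => G.minDegree_le_degree v) hUB huniv hcard
      hcross ?_ ?_ ?_ ?_ ?_
    · intro S hS hSB
      by_contra! h
      exact n4 ⟨#S, mem_Icc.2 ⟨hS.card_pos, hSB.trans hBM⟩, S, rfl, h⟩
    · intro v w hvw
      by_contra! h
      exact n5 (exists_five_of_three_le_codegree hvw h)
    · exact fun v w hvw hv hw h => n6 (hasCloseLow_of_adj hvw hv hw h)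
    · exact fun v w hvw hv hw x h h' => n6 (hasCloseLow_of_adj_adj hvw hv hw h h')
    · exact fun v w hvw hv hw x y z g1 g2 g3 k1 k2 k3 k4 =>
        n6 (hasCloseLow_of_path hvw hv hw g1 g2 g3 k1 k2 k3 k4)

lemma eventually_prob_globalResilience_ne_le {ε : ℝ} (hε : 0 < ε) :
    ∀ᶠ n : ℕ in atTop, Even n → ∀ p : ℝ, 0 ≤ p → p ≤ 1 →
      prob p (fun G : SimpleGraph (Fin n) =>
        globalResilience G HasPerfectMatching ≠ G.minDegree) ≤ ε := by
  filter_upwards [eventually_prob_le_of_log_le hε, eventually_prob_le_of_dense hε,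
    eventually_prob_le_of_sparse hε] with n h1 h2 h3 hn p hp0 hp1
  rcases le_total (n * p) (9 / 10 * Real.log n) with h | h
  · exact h1 hn p hp0 hp1 h
  rcases le_total (n * p) (100 * Real.log n) with h' | h'
  · exact h3 hn p hp0 hp1 h h'
  · exact h2 hn p hp0 hp1 h'

end Asymptotics

end RandomGraph

theorem proposition4p1 (p : ℕ → unitInterval) :
    Filter.Tendsto
      (fun n : ℕ => SimpleGraph.binomialRandom (Fin n) (p n)
        {G : SimpleGraph (Fin n) |
          globalResilience G HasPerfectMatching = (open Classical in G.minDegree)})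
      (Filter.atTop ⊓ Filter.principal {n : ℕ | Even n}) (nhds 1) := by
  classical
  simp_rw [RandomGraph.binomialRandom_eq_ofReal_prob]
  rw [← ENNReal.ofReal_one]
  refine ENNReal.tendsto_ofReal ?_
  rw [Metric.tendsto_nhds]
  intro ε hε
  rw [Filter.eventually_inf_principal]
  filter_upwards [RandomGraph.eventually_prob_globalResilience_ne_le (half_pos hε)] with n hn hnE
  have h1 := hn hnE (p n) (p n).2.1 (p n).2.2
  have h2 := RandomGraph.prob_add_prob_not (p n : ℝ) (fun G : SimpleGraph (Fin n) =>
    globalResilience G HasPerfectMatching = (open Classical in G.minDegree))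
  have h3 := RandomGraph.prob_nonneg (p n).2.1 (p n).2.2 (fun G : SimpleGraph (Fin n) =>
    ¬ globalResilience G HasPerfectMatching = (open Classical in G.minDegree))
  rw [Real.dist_eq, abs_sub_lt_iff]
  constructor <;> linarith
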